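/- Let $d\ge 1$ and $k\ge 0$ be integers. For a smooth function $\phi$ on $\mathbb R^d$ and a weight $w$ put $$T_w\phi(x)=\phi(x)-\sum_{|\alpha|\le k-1}\frac{x^\alpha}{\alpha!}\phi^{(\alpha)}(0)-w(x)\sum_{|\alpha|=k}\frac{x^\alpha}{\alpha!}\phi^{(\alpha)}(0),$$ and $\langle T_wf,\phi\rangle=\langle f,T_w\phi\rangle$ for $\phi\in\mathcal S(\mathbb R^d)$; $T_\mu$ ($\mu>0$) denotes $T_w$ for $w(x)=H(\mu^{-1}-|x|)$, $H$ the Heaviside function. Integrals at infinity involving a general $w$ are understood in the Cesàro sense (as limits of $\int_{|x|<R}(1-|x|/R)^N(\cdot)\,dx$ for some $N$); for $T_\mu$ they are absolutely convergent. Let $P\phi(r)=\int_{|y|=1}\phi(ry)\,d\sigma(y)$ for $r\in\mathbb R$ ($\sigma$ the surface measure), and $\Omega_{d,m}=\int_{|y|=1}y_i^{2m}\,d\sigma(y)$ (for any coordinate $i$). Then: (a) For $\phi\in\mathcal S(\mathbb R^d)$, $P\phi$ is an even Schwartz function on $\mathbb R$, and for all $m\ge 0$, $(P\phi)^{(2m+1)}(0)=0$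 and $(P\phi)^{(2m)}(0)=\Omega_{d,m}\,\Delta^m\phi(0)$. (b) The $T_w$ operators with spherically symmetric weight are consistent under dimensional reduction: if $f,w$ are functions of $r=|x|$ such that $f(r)r^{d+k}$ and $f(r)r^{d-1+k}(1-w(r))$ are integrable on $(0,R)$ for every $R>0$, then for every $\phi\in\mathcal S(\mathbb R^d)$ the evaluation $\langle f(|x|),T_w\phi\rangle_{\mathbb R^d}$ exists if and only if $\langle H(r)f(r)r^{d-1},T_w(P\phi)\rangle_{\mathbb R}$ does (with the one-dimensional $T_w$ of the same order $k$), and then they are equal. (c) Let $w$ satisfy $w(0)=1$, let $(1-w(r))/r$ be integrable on $(0,R)$ for every $R>0$, and let $\int_1^\infty w(r)\,dr/r$ exist in the Cesàro sense. Then $T_w(r^{-d-k})$ is a tempered distribution on $\mathbb R^d$ extending $r^{-d-k}$, $T_w(r_+^{-k-1})$ is a tempered distribution on $\mathbb R$ extending $r_+^{-k-1}=H(r)\,r^{-d-k}\,r^{d-1}$, and $$\langle T_w(r^{-d-k}),\phi\rangle_{\mathbb R^d}=\langle T_w(r_+^{-k-1}),P\phi\rangle_{\mathbb R}\qquad(\phi\in\mathcal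 S(\mathbb R^d)).$$ Likewise, with absolutely convergent integrals, for $T_\mu$, $\mu>0$. (A distribution extends $f$ if it is given by integration against $f$ on the Schwartz functions that vanish at $0$ with all their derivatives.) (d) Let $\mathrm{Pf}(r_+^{-2m-1})$ be the tempered distribution on $\mathbb R$ given by the Hadamard finite part of $\int_\varepsilon^\infty\psi(r)r^{-2m-1}\,dr$ as $\varepsilon\downarrow0$ (multiples of $\varepsilon^{-\theta}$, $\theta\ne0$, $\operatorname{Re}\theta\ge0$, and of $\log\varepsilon$ being discarded), and define $\langle\mathrm{Pf}(r^{-d-2m}),\phi\rangle=\langle\mathrm{Pf}(r_+^{-2m-1}),P\phi\rangle$, a tempered distribution on $\mathbb R^d$. Then for all $m\ge0$ and $\mu>0$ $$T_\mu(r^{-d-2m})=\mathrm{Pf}(r^{-d-2m})+\frac{\Omega_{d,m}}{(2m)!}\,\Delta^m\delta\,\log\mu .$$ -/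

import Mathlib

open MeasureTheory Filter Topology Set
open scoped SchwartzMap Laplacian

noncomputable section

/-- The degree `n` homogeneous part of the Taylor polynomial of `φ` at the origin,
`x ↦ ∑_{|α| = n} x^α φ^(α)(0) / α!`, written without coordinates as `D^n φ(0)(x, …, x) / n!`. -/
def taylorPart {E : Type*} [NormedAddCommGroup E] [NormedSpace ℝ E]
    (φ : E → ℂ) (n : ℕ) (x : E) : ℂ :=
  ((n.factorial : ℂ))⁻¹ * iteratedFDeriv ℝ n φ 0 (fun _ => x)

/-- The operator `T_w` on test functions: the `(k-1)`-jet of `φ` at the origin is subtracted,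
and the part of degree `k` of the Taylor polynomial is subtracted with the weight `w`. -/
def taylorSubtract {E : Type*} [NormedAddCommGroup E] [NormedSpace ℝ E]
    (w : E → ℂ) (k : ℕ) (φ : E → ℂ) (x : E) : ℂ :=
  φ x - ∑ n ∈ Finset.range k, taylorPart φ n x - w x * taylorPart φ k x

/-- `g` is integrable on every ball around the origin and `∫ g = L` in the sense of Cesàro
(means of some order `N`) at infinity. -/
def HasCesaroIntegral {E : Type*} [NormedAddCommGroup E] [MeasureSpace E]
    (g : E → ℂ) (L : ℂ) : Prop :=
  (∀ R : ℝ, IntegrableOn g (Metric.ball 0 R)) ∧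
  ∃ N : ℕ, Tendsto
    (fun R : ℝ => ∫ x in Metric.ball (0 : E) R, (((1 - ‖x‖ / R) ^ N : ℝ) : ℂ) * g x)
    atTop (𝓝 L)

/-- `T` is the distribution `T_w f`, `⟨T_w f, φ⟩ = ⟨f, T_w φ⟩`; the pairing on the right is
evaluated in the Cesàro sense at infinity. -/
def IsWeightedExtension {E : Type*} [NormedAddCommGroup E] [NormedSpace ℝ E] [MeasureSpace E]
    (f w : E → ℂ) (k : ℕ) (T : 𝓢'(E, ℂ)) : Prop :=
  ∀ φ : 𝓢(E, ℂ), HasCesaroIntegral (fun x => f x * taylorSubtract w k φ x) (T φ)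

/-- The weight `w_μ = H(1/μ - |x|)`, as a function of `r = |x|`. -/
def cutoffWeight (μ : ℝ) (r : ℝ) : ℂ := if r ≤ μ⁻¹ then 1 else 0

/-- `T` is the distribution `T_μ f`, i.e. `⟨T, φ⟩ = ⟨f, T_w φ⟩` for the weight `w_μ`;
here the pairing is an absolutely convergent integral. -/
def IsCutoffExtension {E : Type*} [NormedAddCommGroup E] [NormedSpace ℝ E] [MeasureSpace E]
    (f : E → ℂ) (μ : ℝ) (k : ℕ) (T : 𝓢'(E, ℂ)) : Prop :=
  ∀ φ : 𝓢(E, ℂ),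
    Integrable (fun x => f x * taylorSubtract (fun y => cutoffWeight μ ‖y‖) k φ x) ∧
    T φ = ∫ x, f x * taylorSubtract (fun y => cutoffWeight μ ‖y‖) k φ x

/-- `T` extends `f`: it agrees with integration against `f` on the Schwartz functions that
vanish at the origin together with all their derivatives. -/
def IsExtensionOf {E : Type*} [NormedAddCommGroup E] [NormedSpace ℝ E] [MeasureSpace E]
    (f : E → ℂ) (T : 𝓢'(E, ℂ)) : Prop :=
  ∀ φ : 𝓢(E, ℂ), (∀ n : ℕ, iteratedFDeriv ℝ n φ 0 = 0) →
    Integrable (fun x => f x * φ x) ∧ T φ = ∫ x, f x * φ x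

/-- The (unnormalised) spherical average `P φ (r) = ∫_{|y| = 1} φ (r y)`, as an even function
on the whole line; the sphere carries its surface measure. -/
def sphericalSum {d : ℕ} (φ : EuclideanSpace ℝ (Fin d) → ℂ) (r : ℝ) : ℂ :=
  ∫ y : Metric.sphere (0 : EuclideanSpace ℝ (Fin d)) 1, φ (r • (y : EuclideanSpace ℝ (Fin d)))
    ∂((volume : Measure (EuclideanSpace ℝ (Fin d))).toSphere)

/-- The moment `∫_{|y| = 1} y_i ^ (2 m)` of the unit sphere. -/
def sphereMoment {d : ℕ} (i : Fin d) (m : ℕ) : ℝ :=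
  ∫ y : Metric.sphere (0 : EuclideanSpace ℝ (Fin d)) 1,
    ((y : EuclideanSpace ℝ (Fin d)) i) ^ (2 * m)
    ∂((volume : Measure (EuclideanSpace ℝ (Fin d))).toSphere)

/-- The amplitude `f(|x|)` on `ℝ^d`. -/
def radialAmplitude (d : ℕ) (f : ℝ → ℂ) (x : EuclideanSpace ℝ (Fin d)) : ℂ := f ‖x‖

/-- The reduced amplitude `H(r) f(r) r^(d-1)` on the real line. -/
def reducedAmplitude (d : ℕ) (f : ℝ → ℂ) : ℝ → ℂ :=
  (Ioi (0 : ℝ)).indicator (fun r => f r * (r : ℂ) ^ (d - 1))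

/-- The profile `r ^ (-a)`. -/
def inversePower (a : ℕ) (r : ℝ) : ℂ := ((r : ℂ) ^ a)⁻¹

/-- The distribution `T` on `ℝ^d` is obtained from the distribution `S` on the line by
dimensional reduction: `⟨T, φ⟩ = ⟨S, P φ⟩`. -/
def IsReduction {d : ℕ} (T : 𝓢'(EuclideanSpace ℝ (Fin d), ℂ)) (S : 𝓢'(ℝ, ℂ)) : Prop :=
  ∀ (φ : 𝓢(EuclideanSpace ℝ (Fin d), ℂ)) (ψ : 𝓢(ℝ, ℂ)),
    (∀ r, ψ r = sphericalSum φ r) → T φ = S ψ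

/-- Weights, as functions of `r = |x|`: value `1` at the origin with `(1 - w(r)) / r`
integrable there (and hence `w` locally integrable away from it), and decay at infinity
only in the sense that `∫_1^∞ w(r) dr / r` exists as a Cesàro integral. -/
structure IsRadialWeight (w : ℝ → ℂ) : Prop where
  value_zero : w 0 = 1
  integrable_near_zero : ∀ R : ℝ, IntegrableOn (fun r : ℝ => (1 - w r) / (r : ℂ)) (Ioc 0 R)
  cesaro_tail : ∃ L : ℂ, HasCesaroIntegral
    ((Ioi (1 : ℝ)).indicator (fun r : ℝ => w r / (r : ℂ))) L

/-- `L` is the Hadamard finite part of `F(ε)` as `ε ↓ 0`: it is the limit that remains after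
discarding multiples of powers `ε^(-θ)`, with `θ ≠ 0` and `Re θ ≥ 0`, and of `log ε`. -/
def IsFinitePart (F : ℝ → ℂ) (L : ℂ) : Prop :=
  ∃ (s : Finset ℂ) (c : ℂ → ℂ) (b : ℂ), (∀ θ ∈ s, θ ≠ 0 ∧ 0 ≤ θ.re) ∧
    Tendsto (fun ε : ℝ => F ε - ∑ θ ∈ s, c θ * (ε : ℂ) ^ (-θ) - b * (Real.log ε : ℂ))
      (𝓝[>] 0) (𝓝 L)

/-- `S` is the pseudofunction `Pf (H(x) / x^l)` on the real line. -/
def IsPseudofunction (l : ℕ) (S : 𝓢'(ℝ, ℂ)) : Prop :=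
  ∀ ψ : 𝓢(ℝ, ℂ), IsFinitePart (fun ε => ∫ x in Ioi ε, ψ x / (x : ℂ) ^ l) (S ψ)

end

/-! Polar coordinates reduce everything to the line, because spherical summation `P` commutes with
`T_w`: differentiation passes under the integral over the compact sphere, so the degree `n` Taylor
part of `Pφ` is the spherical sum of that of `φ`, and a radial weight is constant on each sphere
(`taylorSubtract_sphericalSum`). Hence the Cesàro means of a radial amplitude against `T_w φ` over
the ball of radius `R` coincide with those on the line for every `R` and every order
(`cesaroMean_radialAmplitude`), which gives (b).

For (a), the even derivatives of `Pφ` at the origin are computed by Fourier inversion: `∂_y^(2m)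
φ(0)` is the integral of `(2πi ξ·y)^(2m)` against the transform of `φ`, and by rotation invariance
the sphere integral of `(ξ·y)^(2m)` is `Ω_{d,m} |ξ|^(2m)`, the symbol of `Δ^m` up to constants
(`sphericalDeriv_even_zero`). Odd derivatives vanish by the symmetry `y ↦ -y`.

On the line, the cutoff at `1` gives an absolutely convergent integral dominated by Schwartz
seminorms, hence a tempered distribution `finitePart k`. Any other weight changes it by `c
ψ^(k)(0)/k!`, where `c = ∫_0^1 (1-w)/r dr - ∫_1^∞ w/r dr`; composing with `P` gives (c). Integrating
the subtracted terms over `r > ε` produces only powers of `ε` and `log ε`, so `finitePart k` is the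
Hadamard finite part. For the cutoff at `1/μ` the constant `c` is `log μ`, and (d) follows from (a).
-/

noncomputable section

/-! ### Homogeneous Taylor parts and the global remainder estimate -/

section Taylor

variable {E : Type*} [NormedAddCommGroup E] [NormedSpace ℝ E]

theorem iteratedDeriv_comp_smul_right {F : Type*} [NormedAddCommGroup F] [NormedSpace ℝ F]
    {φ : E → F} (hφ : ContDiff ℝ (⊤ : ℕ∞) φ) (x : E) (n : ℕ) (t : ℝ) :
    iteratedDeriv n (fun s : ℝ => φ (s • x)) t = iteratedFDeriv ℝ n φ (t • x) (fun _ => x) := by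
  have h := ((ContinuousLinearMap.id ℝ ℝ).smulRight x).iteratedFDeriv_comp_right
    (hφ.of_le (by exact_mod_cast le_top) : ContDiff ℝ n φ) t (i := n) le_rfl
  rw [iteratedDeriv_eq_iteratedFDeriv]
  have h' := congrArg (fun A => A (fun _ => (1 : ℝ))) h
  simpa [Function.comp_def] using h'

theorem norm_taylorPart_le (φ : 𝓢(E, ℂ)) (n : ℕ) (x : E) :
    ‖taylorPart φ n x‖ ≤ SchwartzMap.seminorm ℂ 0 n φ * ‖x‖ ^ n := by
  unfold taylorPart
  rw [norm_mul, norm_inv, Complex.norm_natCast]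
  have h1 : ‖iteratedFDeriv ℝ n φ 0 (fun _ => x)‖ ≤ SchwartzMap.seminorm ℂ 0 n φ * ‖x‖ ^ n := by
    refine (ContinuousMultilinearMap.le_opNorm _ _).trans ?_
    simp only [Finset.prod_const, Finset.card_univ, Fintype.card_fin]
    gcongr
    exact φ.norm_iteratedFDeriv_le_seminorm ℂ n 0
  have h2 : ((n.factorial : ℝ))⁻¹ ≤ 1 := by
    apply inv_le_one_of_one_le₀
    exact_mod_cast n.factorial_pos
  calc _ ≤ 1 * ‖iteratedFDeriv ℝ n φ 0 (fun _ => x)‖ := by gcongr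
    _ ≤ _ := by rw [one_mul]; exact h1

theorem continuous_taylorPart (φ : E → ℂ) (n : ℕ) : Continuous (taylorPart φ n) := by
  unfold taylorPart
  exact continuous_const.mul
    ((iteratedFDeriv ℝ n φ 0).cont.comp (continuous_pi fun _ => continuous_id))

theorem taylorPart_smul (φ : E → ℂ) (n : ℕ) (r : ℝ) (x : E) :
    taylorPart φ n (r • x) = (r : ℂ) ^ n * taylorPart φ n x := by
  unfold taylorPart
  have := (iteratedFDeriv ℝ n φ 0).map_smul_univ (fun _ => r) (fun _ => x)
  simp only [Finset.prod_const, Finset.card_univ, Fintype.card_fin] at this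
  rw [this, Complex.real_smul]
  push_cast
  ring

theorem taylorPart_real (ψ : ℝ → ℂ) (n : ℕ) (r : ℝ) :
    taylorPart ψ n r = (iteratedDeriv n ψ 0 / n.factorial) * (r : ℂ) ^ n := by
  have := taylorPart_smul ψ n r 1
  rw [smul_eq_mul, mul_one] at this
  rw [this, taylorPart, iteratedDeriv_eq_iteratedFDeriv]
  ring

theorem taylorPart_add (φ ψ : 𝓢(E, ℂ)) (n : ℕ) (x : E) :
    taylorPart (φ + ψ : 𝓢(E, ℂ)) n x = taylorPart φ n x + taylorPart ψ n x := by
  unfold taylorPart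
  have h : ((φ + ψ : 𝓢(E, ℂ)) : E → ℂ) = (φ : E → ℂ) + (ψ : E → ℂ) := by ext; simp
  rw [h, iteratedFDeriv_add_apply ((φ.smooth n).contDiffAt) ((ψ.smooth n).contDiffAt)]
  simp [mul_add]

theorem taylorPart_const_smul (c : ℂ) (φ : 𝓢(E, ℂ)) (n : ℕ) (x : E) :
    taylorPart (c • φ : 𝓢(E, ℂ)) n x = c * taylorPart φ n x := by
  unfold taylorPart
  have h : ((c • φ : 𝓢(E, ℂ)) : E → ℂ) = c • (φ : E → ℂ) := by ext; simp
  rw [h, iteratedFDeriv_const_smul_apply ((φ.smooth n).contDiffAt)]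
  simp
  ring

/-- Taylor's formula for Schwartz functions, with a remainder controlled on the whole space. -/
theorem norm_sub_taylor_le (φ : 𝓢(E, ℂ)) (k : ℕ) (x : E) :
    ‖φ x - ∑ n ∈ Finset.range (k + 1), taylorPart φ n x‖ ≤
      SchwartzMap.seminorm ℂ 0 (k + 1) φ * ‖x‖ ^ (k + 1) := by
  -- The one-variable Taylor theorem is applied along the segment from `0` to `x`, and evaluated at
  -- time `1`.
  set g : ℝ → ℂ := fun s => φ (s • x) with hg
  have hgc : ContDiff ℝ (⊤ : ℕ∞) g := (φ.smooth ⊤).comp (by fun_prop)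
  have hgd : ∀ n t, iteratedDeriv n g t = iteratedFDeriv ℝ n φ (t • x) (fun _ => x) :=
    fun n t => iteratedDeriv_comp_smul_right (φ.smooth ⊤) x n t
  have hw : ∀ n, ∀ t ∈ Icc (0 : ℝ) 1,
      iteratedDerivWithin n g (Icc 0 1) t = iteratedFDeriv ℝ n φ (t • x) (fun _ => x) := by
    intro n t ht
    rw [iteratedDerivWithin_eq_iteratedDeriv (uniqueDiffOn_Icc zero_lt_one)
      ((hgc.of_le (by exact_mod_cast le_top)).contDiffAt) ht, hgd]
  have hb := taylor_mean_remainder_bound (f := g) (a := 0) (b := 1)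
    (C := SchwartzMap.seminorm ℂ 0 (k + 1) φ * ‖x‖ ^ (k + 1)) (x := 1) (n := k) zero_le_one
    ((hgc.of_le (by exact_mod_cast le_top)).contDiffOn) (by simp) (by
      intro y hy
      rw [hw _ y hy]
      refine (ContinuousMultilinearMap.le_opNorm _ _).trans ?_
      simp only [Finset.prod_const, Finset.card_univ, Fintype.card_fin]
      gcongr
      exact φ.norm_iteratedFDeriv_le_seminorm ℂ (k + 1) _)
  have ht : taylorWithinEval g k (Icc 0 1) 0 1
      = ∑ n ∈ Finset.range (k + 1), taylorPart φ n x := by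
    rw [taylor_within_apply]
    refine Finset.sum_congr rfl fun n _ => ?_
    rw [hw n 0 (by simp), taylorPart]
    simp
  rw [ht] at hb
  have h1 : (1 : ℝ) ≤ k.factorial := by exact_mod_cast k.factorial_pos
  calc _ ≤ _ := by simpa [hg] using hb
    _ ≤ _ := div_le_self (by positivity) h1

theorem taylorSubtract_eq (w : E → ℂ) (k : ℕ) (φ : E → ℂ) (x : E) :
    taylorSubtract w k φ x = (φ x - ∑ n ∈ Finset.range (k + 1), taylorPart φ n x)
      + (1 - w x) * taylorPart φ k x := by
  rw [taylorSubtract, Finset.sum_range_succ]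
  ring

end Taylor

/-! ### Local integrability of an amplitude against `T_w φ` -/

section Integrability

variable {X : Type*} [MeasurableSpace X] {ν : Measure X}

/-- If `p b` is integrable for a real function `b` dominating `q`, then `p q` is integrable. -/
theorem MeasureTheory.Integrable.mul_of_norm_le {p q : X → ℂ} {b : X → ℝ} {C : ℝ}
    (h : Integrable (fun x => p x * (b x : ℂ)) ν) (hb : Measurable b)
    (hq : Measurable q) (hC : ∀ x, ‖q x‖ ≤ C * b x) :
    Integrable (fun x => p x * q x) ν := by
  -- The quotient `q / b` is bounded and measurable, so `p` itself need not be measurable; where `b`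
  -- vanishes, so does `q`.
  have key : (fun x => p x * q x) = fun x => (p x * (b x : ℂ)) * (q x / (b x : ℂ)) := by
    ext x
    by_cases hx : b x = 0
    · have : q x = 0 := by simpa [hx] using hC x
      simp [hx, this]
    · have : (b x : ℂ) ≠ 0 := by exact_mod_cast hx
      field_simp
  rw [key]
  refine h.mul_bdd (c := |C|) ?_ ?_
  · exact (hq.div (Complex.measurable_ofReal.comp hb)).aestronglyMeasurable
  · refine Eventually.of_forall fun x => ?_
    rw [norm_div, Complex.norm_real, Real.norm_eq_abs]
    refine div_le_of_le_mul₀ (abs_nonneg _) (abs_nonneg _) ?_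
    exact (hC x).trans ((le_abs_self _).trans (abs_mul _ _).le)

variable {E : Type*} [NormedAddCommGroup E] [NormedSpace ℝ E] [MeasurableSpace E] [BorelSpace E]

/-- `T_w φ` splits into the full Taylor remainder, of size `‖x‖^(k+1)`, and `1 - w` times the degree
`k` part, of size `‖x‖^k`; each hypothesis controls one piece. -/
theorem integrable_mul_taylorSubtract {ν : Measure E} {f w : E → ℂ} {k : ℕ}
    (h₁ : Integrable (fun x => f x * ((‖x‖ ^ (k + 1) : ℝ) : ℂ)) ν)
    (h₂ : Integrable (fun x => f x * (1 - w x) * ((‖x‖ ^ k : ℝ) : ℂ)) ν) (φ : 𝓢(E, ℂ)) :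
    Integrable (fun x => f x * taylorSubtract w k φ x) ν := by
  have e : (fun x => f x * taylorSubtract w k φ x) = fun x =>
      f x * (φ x - ∑ n ∈ Finset.range (k + 1), taylorPart φ n x)
        + f x * (1 - w x) * taylorPart φ k x := by
    ext x; rw [taylorSubtract_eq]; ring
  rw [e]
  refine (h₁.mul_of_norm_le (by fun_prop) ?_ (norm_sub_taylor_le φ k)).add
    (h₂.mul_of_norm_le (by fun_prop) (continuous_taylorPart φ k).measurable
      (norm_taylorPart_le φ k))
  exact (φ.continuous.sub (continuous_finsetSum _ fun n _ => continuous_taylorPart φ n)).measurable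

end Integrability

/-! ### Spherical summation on Schwartz functions -/

section SphericalSum

variable {d : ℕ}

/-- The integral over the unit sphere of the `n`-th radial derivative of `φ` at distance `r`. -/
def sphericalDeriv (φ : EuclideanSpace ℝ (Fin d) → ℂ) (n : ℕ) (r : ℝ) : ℂ :=
  ∫ y : Metric.sphere (0 : EuclideanSpace ℝ (Fin d)) 1,
    iteratedFDeriv ℝ n φ (r • (y : EuclideanSpace ℝ (Fin d))) (fun _ => y)
    ∂((volume : Measure (EuclideanSpace ℝ (Fin d))).toSphere)

theorem sphericalDeriv_zero (φ : EuclideanSpace ℝ (Fin d) → ℂ) :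
    sphericalDeriv φ 0 = sphericalSum φ := by
  ext r; simp [sphericalDeriv, sphericalSum]

theorem Continuous.integrable_toSphere {F : Type*} [NormedAddCommGroup F]
    {g : Metric.sphere (0 : EuclideanSpace ℝ (Fin d)) 1 → F} (hg : Continuous g) :
    Integrable g ((volume : Measure (EuclideanSpace ℝ (Fin d))).toSphere) :=
  hg.integrable_of_hasCompactSupport (HasCompactSupport.of_compactSpace g)

theorem continuous_iteratedFDeriv_sphere (φ : 𝓢(EuclideanSpace ℝ (Fin d), ℂ)) (n : ℕ) (r : ℝ) :
    Continuous fun y : Metric.sphere (0 : EuclideanSpace ℝ (Fin d)) 1 =>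
      iteratedFDeriv ℝ n φ (r • (y : EuclideanSpace ℝ (Fin d))) (fun _ => (y : _)) := by
  have h1 : Continuous (iteratedFDeriv ℝ n φ) := (φ.smooth n).continuous_iteratedFDeriv le_rfl
  have h2 : Continuous fun y : Metric.sphere (0 : EuclideanSpace ℝ (Fin d)) 1 =>
      iteratedFDeriv ℝ n φ (r • (y : EuclideanSpace ℝ (Fin d))) := h1.comp (by fun_prop)
  have h3 : Continuous fun y : Metric.sphere (0 : EuclideanSpace ℝ (Fin d)) 1 =>
      (fun _ : Fin n => (y : EuclideanSpace ℝ (Fin d))) := by fun_prop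
  exact h2.eval h3

theorem norm_iteratedFDeriv_sphere_le (φ : 𝓢(EuclideanSpace ℝ (Fin d), ℂ)) (n : ℕ) (r : ℝ)
    (y : Metric.sphere (0 : EuclideanSpace ℝ (Fin d)) 1) :
    ‖iteratedFDeriv ℝ n φ (r • (y : EuclideanSpace ℝ (Fin d))) (fun _ => (y : _))‖ ≤
      ‖iteratedFDeriv ℝ n φ (r • (y : EuclideanSpace ℝ (Fin d)))‖ := by
  refine (ContinuousMultilinearMap.le_opNorm _ _).trans ?_
  simp

/-- Differentiation under the integral sign: the surface measure is finite and a Schwartz seminorm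
bounds the next derivative uniformly. -/
theorem hasDerivAt_sphericalDeriv (φ : 𝓢(EuclideanSpace ℝ (Fin d), ℂ)) (n : ℕ) (r : ℝ) :
    HasDerivAt (sphericalDeriv φ n) (sphericalDeriv φ (n + 1) r) r := by
  refine (hasDerivAt_integral_of_dominated_loc_of_deriv_le (s := univ)
    (bound := fun _ => SchwartzMap.seminorm ℂ 0 (n + 1) φ) univ_mem
    (Eventually.of_forall fun s => (continuous_iteratedFDeriv_sphere φ n s).aestronglyMeasurable)
    (continuous_iteratedFDeriv_sphere φ n r).integrable_toSphere
    (F' := fun s y => iteratedFDeriv ℝ (n + 1) φ (s • (y : EuclideanSpace ℝ (Fin d)))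
      (fun _ => (y : _)))
    (continuous_iteratedFDeriv_sphere φ (n + 1) r).aestronglyMeasurable
    (Eventually.of_forall fun y s _ => ?_) (integrable_const _)
    (Eventually.of_forall fun y s _ => ?_)).2
  · exact (norm_iteratedFDeriv_sphere_le φ _ s y).trans
      (φ.norm_iteratedFDeriv_le_seminorm ℂ (n + 1) _)
  · have h : ∀ m, iteratedDeriv m (fun t : ℝ => φ (t • (y : EuclideanSpace ℝ (Fin d))))
        = fun t => iteratedFDeriv ℝ m φ (t • (y : EuclideanSpace ℝ (Fin d))) (fun _ => (y : _)) :=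
      fun m => funext fun t => iteratedDeriv_comp_smul_right (φ.smooth ⊤) _ m t
    have hc : ContDiff ℝ (⊤ : ℕ∞) (fun t : ℝ => φ (t • (y : EuclideanSpace ℝ (Fin d)))) :=
      (φ.smooth ⊤).comp (by fun_prop)
    have hd := (hc.differentiable_iteratedDeriv n
      (by exact_mod_cast ENat.natCast_lt_top n) s).hasDerivAt
    rw [← iteratedDeriv_succ, h n, h (n + 1)] at hd
    exact hd

theorem iteratedDeriv_sphericalSum (φ : 𝓢(EuclideanSpace ℝ (Fin d), ℂ)) (n : ℕ) :
    iteratedDeriv n (sphericalSum φ) = sphericalDeriv φ n := by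
  induction n with
  | zero => rw [iteratedDeriv_zero, sphericalDeriv_zero]
  | succ n ih =>
    rw [iteratedDeriv_succ, ih]
    exact funext fun r => (hasDerivAt_sphericalDeriv φ n r).deriv

theorem contDiff_sphericalSum (φ : 𝓢(EuclideanSpace ℝ (Fin d), ℂ)) :
    ContDiff ℝ (⊤ : ℕ∞) (sphericalSum φ) := by
  refine contDiff_of_differentiable_iteratedDeriv fun m _ => ?_
  rw [iteratedDeriv_sphericalSum]
  exact fun r => (hasDerivAt_sphericalDeriv φ m r).differentiableAt

/-- Since `‖r • y‖ = |r|` on the unit sphere, decay of `φ` passes to the spherical sum at the cost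
of the total surface area. This supplies the continuity of `P`. -/
theorem norm_pow_mul_sphericalDeriv_le (φ : 𝓢(EuclideanSpace ℝ (Fin d), ℂ)) (k n : ℕ) (r : ℝ) :
    ‖r‖ ^ k * ‖sphericalDeriv φ n r‖ ≤
      ((volume : Measure (EuclideanSpace ℝ (Fin d))).toSphere).real univ
        * SchwartzMap.seminorm ℂ k n φ := by
  have : ‖((r ^ k : ℝ) : ℂ) * sphericalDeriv φ n r‖ ≤ SchwartzMap.seminorm ℂ k n φ *
      ((volume : Measure (EuclideanSpace ℝ (Fin d))).toSphere).real univ := by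
    rw [sphericalDeriv, ← integral_const_mul]
    refine norm_integral_le_of_norm_le_const (Eventually.of_forall fun y => ?_)
    rw [norm_mul, Complex.norm_real, norm_pow]
    refine le_trans ?_ (φ.le_seminorm ℂ k n (r • (y : EuclideanSpace ℝ (Fin d))))
    have hy : ‖(y : EuclideanSpace ℝ (Fin d))‖ = 1 := by simp
    rw [norm_smul, hy, mul_one]
    gcongr
    exact norm_iteratedFDeriv_sphere_le φ n r y
  rw [norm_mul, Complex.norm_real, norm_pow] at this
  rw [mul_comm _ (SchwartzMap.seminorm ℂ k n φ)]
  exact this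

/-- Spherical summation as a continuous linear map from Schwartz functions on `ℝ^d` to Schwartz
functions on the line. -/
def sphericalSumCLM (d : ℕ) : 𝓢(EuclideanSpace ℝ (Fin d), ℂ) →L[ℂ] 𝓢(ℝ, ℂ) :=
  SchwartzMap.mkCLM (fun φ => sphericalSum φ)
    (fun φ ψ r => by
      simp only [sphericalSum, add_apply]
      exact integral_add (Continuous.integrable_toSphere (by fun_prop))
        (Continuous.integrable_toSphere (by fun_prop)))
    (fun c φ r => by
      simp only [sphericalSum, smul_apply]
      exact integral_smul c _)
    contDiff_sphericalSum
    (fun n => ⟨{n}, ((volume : Measure (EuclideanSpace ℝ (Fin d))).toSphere).real univ,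
      measureReal_nonneg, fun φ r => by
        rw [norm_iteratedFDeriv_eq_norm_iteratedDeriv, iteratedDeriv_sphericalSum]
        rw [Finset.sup_singleton]
        exact norm_pow_mul_sphericalDeriv_le φ n.1 n.2 r⟩)

theorem sphericalSumCLM_apply (φ : 𝓢(EuclideanSpace ℝ (Fin d), ℂ)) (r : ℝ) :
    sphericalSumCLM d φ r = sphericalSum φ r := rfl

theorem coe_sphericalSumCLM (φ : 𝓢(EuclideanSpace ℝ (Fin d), ℂ)) :
    (sphericalSumCLM d φ : ℝ → ℂ) = sphericalSum φ := rfl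

theorem taylorPart_sphericalSum (φ : 𝓢(EuclideanSpace ℝ (Fin d), ℂ)) (n : ℕ) (r : ℝ) :
    taylorPart (sphericalSum φ) n r =
      ∫ y : Metric.sphere (0 : EuclideanSpace ℝ (Fin d)) 1,
        taylorPart φ n (r • (y : EuclideanSpace ℝ (Fin d)))
        ∂((volume : Measure (EuclideanSpace ℝ (Fin d))).toSphere) := by
  rw [taylorPart_real, iteratedDeriv_sphericalSum]
  simp_rw [taylorPart_smul, taylorPart]
  rw [integral_const_mul, integral_const_mul, sphericalDeriv]
  simp only [zero_smul]
  ring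

/-- The commutation of `P` with `T_w`: the weight takes the constant value `w |r|` on the sphere of
radius `|r|` and leaves the integral. -/
theorem taylorSubtract_sphericalSum (φ : 𝓢(EuclideanSpace ℝ (Fin d), ℂ)) (w : ℝ → ℂ) (k : ℕ)
    (r : ℝ) :
    taylorSubtract (fun s => w ‖s‖) k (sphericalSum φ) r =
      ∫ y : Metric.sphere (0 : EuclideanSpace ℝ (Fin d)) 1,
        taylorSubtract (fun x => w ‖x‖) k φ (r • (y : EuclideanSpace ℝ (Fin d)))
        ∂((volume : Measure (EuclideanSpace ℝ (Fin d))).toSphere) := by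
  have hy : ∀ y : Metric.sphere (0 : EuclideanSpace ℝ (Fin d)) 1,
      ‖(y : EuclideanSpace ℝ (Fin d))‖ = 1 := fun y => by simp
  have ht : ∀ n, Integrable (fun y : Metric.sphere (0 : EuclideanSpace ℝ (Fin d)) 1 =>
      taylorPart φ n (r • (y : EuclideanSpace ℝ (Fin d))))
        ((volume : Measure (EuclideanSpace ℝ (Fin d))).toSphere) := fun n =>
    Continuous.integrable_toSphere ((continuous_taylorPart φ n).comp (by fun_prop))
  have h0 : Integrable (fun y : Metric.sphere (0 : EuclideanSpace ℝ (Fin d)) 1 =>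
      φ (r • (y : EuclideanSpace ℝ (Fin d))))
        ((volume : Measure (EuclideanSpace ℝ (Fin d))).toSphere) :=
    Continuous.integrable_toSphere (by fun_prop)
  simp only [taylorSubtract, norm_smul, hy, mul_one]
  have e₁ := integral_sub (h0.sub (integrable_finsetSum (Finset.range k) fun n _ => ht n))
    ((ht k).const_mul (w ‖r‖))
  have e₂ := integral_sub h0 (integrable_finsetSum (Finset.range k) fun n _ => ht n)
  simp only [Pi.sub_apply] at e₁
  rw [e₁, e₂, integral_finsetSum _ fun n _ => ht n, integral_const_mul]
  simp_rw [taylorPart_sphericalSum]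
  rfl

end SphericalSum

/-! ### Polar coordinates -/

section Polar

variable {E : Type*} [NormedAddCommGroup E] [NormedSpace ℝ E] [MeasurableSpace E] [BorelSpace E]
  [FiniteDimensional ℝ E] [Nontrivial E] {μ : Measure E} [μ.IsAddHaarMeasure]

/-- Integration in polar coordinates. -/
theorem MeasureTheory.Integrable.integral_eq_integral_sphere {F : Type*} [NormedAddCommGroup F]
    [NormedSpace ℝ F] {g : E → F} (hg : Integrable g μ) :
    ∫ x, g x ∂μ = ∫ r in Ioi (0 : ℝ), r ^ (Module.finrank ℝ E - 1) •
      ∫ y : Metric.sphere (0 : E) 1, g (r • (y : E)) ∂μ.toSphere := by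
  have hmp := μ.measurePreserving_homeomorphUnitSphereProd
  have hemb := (homeomorphUnitSphereProd E).measurableEmbedding
  set G : Metric.sphere (0 : E) 1 × Ioi (0 : ℝ) → F :=
    fun p => g ((homeomorphUnitSphereProd E).symm p) with hG
  have hGint : Integrable G (μ.toSphere.prod (.volumeIoiPow (Module.finrank ℝ E - 1))) := by
    rw [← hmp.integrable_comp_emb hemb]
    have : G ∘ homeomorphUnitSphereProd E = g ∘ Subtype.val := by
      ext x; simp [hG, -homeomorphUnitSphereProd_symm_apply_coe]
    rw [this, ← integrableOn_iff_comap_subtypeVal (measurableSet_singleton _).compl]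
    exact hg.integrableOn
  calc ∫ x, g x ∂μ = ∫ x : ({(0)}ᶜ : Set E), g x.1 ∂(μ.comap (↑)) := by
        rw [integral_subtype_comap (measurableSet_singleton _).compl fun x ↦ g x,
          restrict_compl_singleton]
    _ = ∫ p, G p ∂μ.toSphere.prod (.volumeIoiPow (Module.finrank ℝ E - 1)) := by
        rw [← hmp.integral_comp hemb]
        simp [hG, -homeomorphUnitSphereProd_symm_apply_coe]
    _ = ∫ r, ∫ y, G (y, r) ∂μ.toSphere ∂(.volumeIoiPow (Module.finrank ℝ E - 1)) :=
        integral_prod_symm _ hGint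
    _ = ∫ r : Ioi (0 : ℝ), ∫ y : Metric.sphere (0 : E) 1, g ((r : ℝ) • (y : E)) ∂μ.toSphere
          ∂(.volumeIoiPow (Module.finrank ℝ E - 1)) := by
        simp [hG]
    _ = _ := by
        simp only [Measure.volumeIoiPow, ENNReal.ofReal]
        rw [integral_withDensity_eq_integral_smul,
          integral_subtype_comap measurableSet_Ioi fun a ↦
            Real.toNNReal (a ^ (Module.finrank ℝ E - 1)) •
              ∫ y : Metric.sphere (0 : E) 1, g (a • (y : E)) ∂μ.toSphere,
          setIntegral_congr_fun measurableSet_Ioi fun x hx ↦ ?_]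
        · rw [NNReal.smul_def, Real.coe_toNNReal _ (pow_nonneg (le_of_lt hx) _)]
        · exact (measurable_subtype_coe.pow_const _).real_toNNReal

/-- Writes a surface integral as a volume integral of a function of the direction alone, so that
symmetries of Lebesgue measure transfer to the sphere. -/
theorem integral_ball_direction {g : E → ℂ} (hg : Continuous g) :
    ∫ x in Metric.ball (0 : E) 1, g (‖x‖⁻¹ • x) ∂μ =
      ((∫ r in Ioo (0 : ℝ) 1, r ^ (Module.finrank ℝ E - 1) : ℝ) : ℂ) *
        ∫ y : Metric.sphere (0 : E) 1, g y ∂μ.toSphere := by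
  -- The bound is taken on the closed ball and not only on the sphere, since `‖x‖⁻¹ • x` is `0` at
  -- the origin.
  obtain ⟨C, hC⟩ := (isCompact_closedBall (0 : E) 1).exists_bound_of_continuousOn hg.continuousOn
  have hint : IntegrableOn (fun x : E => g (‖x‖⁻¹ • x)) (Metric.ball 0 1) μ := by
    refine Measure.integrableOn_of_bounded (M := C) measure_ball_lt_top.ne ?_ ?_
    · exact (hg.measurable.comp (by fun_prop)).aestronglyMeasurable
    · refine Eventually.of_forall fun x => hC _ ?_
      rw [mem_closedBall_zero_iff, norm_smul, norm_inv, norm_norm]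
      exact inv_mul_le_one
  rw [← integral_indicator measurableSet_ball,
    ((integrable_indicator_iff measurableSet_ball).2 hint).integral_eq_integral_sphere]
  have : ∀ r ∈ Ioi (0 : ℝ), (r ^ (Module.finrank ℝ E - 1) •
      ∫ y : Metric.sphere (0 : E) 1, (Metric.ball (0 : E) 1).indicator
        (fun x => g (‖x‖⁻¹ • x)) (r • (y : E)) ∂μ.toSphere) =
      ((Ioo (0 : ℝ) 1).indicator (fun r => ((r ^ (Module.finrank ℝ E - 1) : ℝ) : ℂ)) r) *
        ∫ y : Metric.sphere (0 : E) 1, g y ∂μ.toSphere := by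
    intro r hr
    have hr0 : 0 < r := hr
    have hn : ∀ y : Metric.sphere (0 : E) 1, ‖r • (y : E)‖ = r := fun y => by
      simp [norm_smul, abs_of_pos hr0]
    by_cases h1 : r < 1
    · have : ∀ y : Metric.sphere (0 : E) 1, (Metric.ball (0 : E) 1).indicator
          (fun x => g (‖x‖⁻¹ • x)) (r • (y : E)) = g y := fun y => by
        rw [indicator_of_mem (by rw [mem_ball_zero_iff, hn]; exact h1), hn, smul_smul,
          inv_mul_cancel₀ hr0.ne', one_smul]
      simp_rw [this]
      rw [indicator_of_mem (show r ∈ Ioo (0 : ℝ) 1 from ⟨hr0, h1⟩), Complex.real_smul]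
    · have : ∀ y : Metric.sphere (0 : E) 1, (Metric.ball (0 : E) 1).indicator
          (fun x => g (‖x‖⁻¹ • x)) (r • (y : E)) = 0 := fun y => by
        rw [indicator_of_notMem (by rw [mem_ball_zero_iff, hn]; exact h1)]
      simp_rw [this]
      rw [indicator_of_notMem (fun h => h1 h.2)]
      simp
  rw [setIntegral_congr_fun measurableSet_Ioi this, integral_mul_const,
    setIntegral_indicator measurableSet_Ioo, inter_eq_self_of_subset_right (fun x hx => hx.1)]
  congr 1
  exact integral_ofReal

end Polar

/-! ### Rotation invariance and moments of the sphere -/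

section Isometry

variable {E : Type*} [NormedAddCommGroup E] [InnerProductSpace ℝ E] [MeasurableSpace E]
  [BorelSpace E] [FiniteDimensional ℝ E] [Nontrivial E]

/-- The surface measure of the unit sphere is invariant under linear isometries. -/
theorem integral_toSphere_comp_linearIsometryEquiv (U : E ≃ₗᵢ[ℝ] E) {g : E → ℂ}
    (hg : Continuous g) :
    ∫ y : Metric.sphere (0 : E) 1, g (U y) ∂((volume : Measure E).toSphere) =
      ∫ y : Metric.sphere (0 : E) 1, g y ∂((volume : Measure E).toSphere) := by
  have h₁ := integral_ball_direction (μ := (volume : Measure E)) hg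
  have h₂ := integral_ball_direction (μ := (volume : Measure E)) (g := fun x => g (U x))
    (hg.comp U.continuous)
  have h₃ : ∫ x in Metric.ball (0 : E) 1, g (U (‖x‖⁻¹ • x)) =
      ∫ x in Metric.ball (0 : E) 1, g (‖x‖⁻¹ • x) := by
    have := U.measurePreserving.setIntegral_preimage_emb
      U.toHomeomorph.measurableEmbedding (fun x => g (‖x‖⁻¹ • x)) (Metric.ball 0 1)
    rw [← this, LinearIsometryEquiv.preimage_ball]
    simp
  rw [h₂, h₁] at h₃
  -- Both sides carry the radial factor `∫_0^1 r^(dim - 1) dr = 1/dim`, which is nonzero and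
  -- cancels.
  refine mul_left_cancel₀ ?_ h₃
  have : (∫ r in Ioo (0 : ℝ) 1, r ^ (Module.finrank ℝ E - 1)) =
      1 / ((Module.finrank ℝ E - 1 : ℕ) + 1) := by
    rw [← integral_Ioc_eq_integral_Ioo, ← intervalIntegral.integral_of_le zero_le_one]
    simp
  rw [this]
  norm_cast
  positivity

/-- The even moments of the unit sphere in the direction `ξ`. -/
theorem integral_toSphere_inner_pow {e : E} (he : ‖e‖ = 1) (ξ : E) (n : ℕ) :
    ∫ y : Metric.sphere (0 : E) 1, ((inner ℝ ξ (y : E) : ℝ) : ℂ) ^ n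
      ∂((volume : Measure E).toSphere) =
    (‖ξ‖ : ℂ) ^ n * ∫ y : Metric.sphere (0 : E) 1, ((inner ℝ e (y : E) : ℝ) : ℂ) ^ n
      ∂((volume : Measure E).toSphere) := by
  have hv : ‖‖ξ‖ • e‖ = ‖ξ‖ := by rw [norm_smul, he, norm_norm, mul_one]
  -- The reflection exchanging the vectors `‖ξ‖ • e` and `ξ` of equal norm; it turns `ξ·y` into `‖ξ‖
  -- (e·y)`.
  set U := (ℝ ∙ (‖ξ‖ • e - ξ))ᗮ.reflection
  have hU : U (‖ξ‖ • e) = ξ := Submodule.reflection_sub hv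
  rw [← integral_toSphere_comp_linearIsometryEquiv U (g := fun y => ((inner ℝ ξ y : ℝ) : ℂ) ^ n)
    (by fun_prop), ← integral_const_mul]
  refine integral_congr_ae (Eventually.of_forall fun y => ?_)
  have : inner ℝ ξ (U (y : E)) = ‖ξ‖ * inner ℝ e (y : E) := by
    conv_lhs => rw [← hU]
    rw [U.inner_map_map, real_inner_smul_left]
  simp only [this]
  push_cast
  ring

end Isometry

/-! ### Parity of the spherical sum -/

section Parity

variable {d : ℕ} [Nontrivial (EuclideanSpace ℝ (Fin d))]

theorem sphericalSum_neg (φ : 𝓢(EuclideanSpace ℝ (Fin d), ℂ)) (r : ℝ) :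
    sphericalSum φ (-r) = sphericalSum φ r := by
  have := integral_toSphere_comp_linearIsometryEquiv
    (LinearIsometryEquiv.neg ℝ (E := EuclideanSpace ℝ (Fin d))) (g := fun y => φ (r • y))
    (by fun_prop)
  simpa [sphericalSum] using this

theorem iteratedDeriv_odd_sphericalSum (φ : 𝓢(EuclideanSpace ℝ (Fin d), ℂ)) (m : ℕ) :
    iteratedDeriv (2 * m + 1) (sphericalSum φ) 0 = 0 := by
  have h := iteratedDeriv_comp_neg (2 * m + 1) (sphericalSum φ) 0
  simp only [sphericalSum_neg, neg_zero] at h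
  rw [Odd.neg_one_pow ⟨m, rfl⟩] at h
  simpa [self_eq_neg] using h

end Parity

/-! ### Fourier symbols of directional derivatives and of the Laplacian -/

section Fourier

open scoped FourierTransform LineDeriv

variable {E : Type*} [NormedAddCommGroup E] [InnerProductSpace ℝ E] [MeasurableSpace E]
  [BorelSpace E] [FiniteDimensional ℝ E]

theorem SchwartzMap.apply_zero_eq_integral_fourier (f : 𝓢(E, ℂ)) : f 0 = ∫ ξ, 𝓕 f ξ := by
  have h : f = 𝓕⁻ (𝓕 f) := (FourierTransform.fourierInv_fourier_eq f).symm
  conv_lhs => rw [h, SchwartzMap.fourierInv_coe, Real.fourierInv_eq']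
  simp

theorem SchwartzMap.fourier_iterate_lineDeriv (f : 𝓢(E, ℂ)) (y : E) (n : ℕ) (ξ : E) :
    𝓕 (∂^{fun _ : Fin n => y} f) ξ =
      (2 * Real.pi * Complex.I * (inner ℝ ξ y : ℝ)) ^ n * 𝓕 f ξ := by
  induction n with
  | zero => simp
  | succ n ih =>
    rw [LineDeriv.iteratedLineDerivOp_succ_left, SchwartzMap.fourier_lineDerivOp_eq]
    have ht : (inner ℝ · y : E → ℝ).HasTemperateGrowth := by fun_prop
    rw [smul_apply, SchwartzMap.smulLeftCLM_apply_apply ht]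
    have : (Fin.tail fun _ : Fin (n + 1) => y) = fun _ : Fin n => y := rfl
    rw [this, ih]
    simp only [smul_eq_mul, Complex.real_smul]
    ring

theorem SchwartzMap.fourier_iterate_laplacian (f : 𝓢(E, ℂ)) (m : ℕ) (ξ : E) :
    𝓕 ((Δ^[m]) f) ξ = (2 * Real.pi * Complex.I * (‖ξ‖ : ℝ)) ^ (2 * m) * 𝓕 f ξ := by
  induction m with
  | zero => simp
  | succ m ih =>
    rw [Function.iterate_succ_apply', SchwartzMap.laplacian_eq_fourierMultiplierCLM,
      SchwartzMap.fourierMultiplierCLM_apply, FourierTransform.fourier_smul,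
      FourierTransform.fourier_fourierInv_eq]
    have ht : ((‖·‖ ^ 2) : E → ℝ).HasTemperateGrowth := by fun_prop
    rw [smul_apply, SchwartzMap.smulLeftCLM_apply_apply ht, ih, Complex.real_smul,
      Complex.real_smul, mul_add, pow_add]
    push_cast
    have hI : Complex.I ^ 2 = -1 := Complex.I_sq
    linear_combination (-(2 * Real.pi * (‖ξ‖ : ℂ)) ^ 2 *
      ((2 * Real.pi * Complex.I * (‖ξ‖ : ℂ)) ^ (2 * m) * 𝓕 f ξ)) * hI

end Fourier

/-! ### Even derivatives of the spherical sum at the origin -/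

section Moments

open scoped FourierTransform LineDeriv

variable {d : ℕ}

/-- On the Fourier side the directional derivative becomes the polynomial `(2πi ξ·y)^(2m)`;
averaging over `y` first leaves a multiple of `|ξ|^(2m)`, so no multi-index expansion is needed. -/
theorem sphericalDeriv_even_zero [Nontrivial (EuclideanSpace ℝ (Fin d))]
    (φ : 𝓢(EuclideanSpace ℝ (Fin d), ℂ)) (m : ℕ) (i : Fin d) :
    sphericalDeriv φ (2 * m) 0 = (sphereMoment i m : ℂ) * ((Δ^[m]) φ) 0 := by
  set σ := (volume : Measure (EuclideanSpace ℝ (Fin d))).toSphere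
  set e : EuclideanSpace ℝ (Fin d) := EuclideanSpace.single i 1
  have he : ‖e‖ = 1 := by simp [e]
  have hΩ : ∫ y : Metric.sphere (0 : EuclideanSpace ℝ (Fin d)) 1,
      ((inner ℝ e (y : EuclideanSpace ℝ (Fin d)) : ℝ) : ℂ) ^ (2 * m) ∂σ = sphereMoment i m := by
    rw [sphereMoment, ← integral_complex_ofReal]
    simp [e, EuclideanSpace.inner_single_left, σ]
  have h1 : ∀ y : Metric.sphere (0 : EuclideanSpace ℝ (Fin d)) 1,
      iteratedFDeriv ℝ (2 * m) φ ((0 : ℝ) • (y : EuclideanSpace ℝ (Fin d))) (fun _ => (y : _)) =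
        ∫ ξ, (2 * Real.pi * Complex.I *
          (inner ℝ ξ (y : EuclideanSpace ℝ (Fin d)) : ℝ)) ^ (2 * m) * 𝓕 φ ξ := by
    intro y
    rw [zero_smul, ← SchwartzMap.iteratedLineDerivOp_eq_iteratedFDeriv,
      SchwartzMap.apply_zero_eq_integral_fourier]
    simp_rw [SchwartzMap.fourier_iterate_lineDeriv]
  -- Fubini's hypothesis: `|ξ·y| ≤ ‖ξ‖` on the unit sphere, and `‖ξ‖^(2m)` times the Schwartz
  -- function `𝓕 φ` is integrable.
  have hint : Integrable (fun p : Metric.sphere (0 : EuclideanSpace ℝ (Fin d)) 1 ×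
      EuclideanSpace ℝ (Fin d) => (2 * Real.pi * Complex.I *
        (inner ℝ p.2 (p.1 : EuclideanSpace ℝ (Fin d)) : ℝ)) ^ (2 * m) * 𝓕 φ p.2)
      (σ.prod volume) := by
    have hb : Integrable (fun ξ : EuclideanSpace ℝ (Fin d) =>
        (2 * Real.pi) ^ (2 * m) * (‖ξ‖ ^ (2 * m) * ‖𝓕 φ ξ‖)) :=
      ((𝓕 φ).integrable_pow_mul volume (2 * m)).const_mul _
    refine (hb.comp_snd σ).mono' (Continuous.aestronglyMeasurable (by fun_prop))
      (Eventually.of_forall fun p => ?_)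
    have hy : ‖(p.1 : EuclideanSpace ℝ (Fin d))‖ = 1 := by simp
    have hi : |inner ℝ p.2 (p.1 : EuclideanSpace ℝ (Fin d))| ≤ ‖p.2‖ := by
      simpa [hy] using abs_real_inner_le_norm p.2 (p.1 : EuclideanSpace ℝ (Fin d))
    simp only [norm_mul, norm_pow, Complex.norm_ofNat, Complex.norm_real, Complex.norm_I,
      Real.norm_eq_abs, abs_of_pos Real.pi_pos, mul_one]
    rw [mul_pow, mul_assoc]
    gcongr
  calc sphericalDeriv φ (2 * m) 0
      = ∫ y : Metric.sphere (0 : EuclideanSpace ℝ (Fin d)) 1, (∫ ξ, (2 * Real.pi * Complex.I *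
          (inner ℝ ξ (y : EuclideanSpace ℝ (Fin d)) : ℝ)) ^ (2 * m) * 𝓕 φ ξ) ∂σ := by
        simp only [sphericalDeriv, h1]; rfl
    _ = ∫ ξ, ∫ y : Metric.sphere (0 : EuclideanSpace ℝ (Fin d)) 1, (2 * Real.pi * Complex.I *
          (inner ℝ ξ (y : EuclideanSpace ℝ (Fin d)) : ℝ)) ^ (2 * m) * 𝓕 φ ξ ∂σ :=
        integral_integral_swap hint
    _ = ∫ ξ, (sphereMoment i m : ℂ) * 𝓕 ((Δ^[m]) φ) ξ := by
        refine integral_congr_ae (Eventually.of_forall fun ξ => ?_)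
        simp only [mul_pow _ ((_ : ℝ) : ℂ)]
        rw [integral_mul_const, integral_const_mul, integral_toSphere_inner_pow he, hΩ,
          SchwartzMap.fourier_iterate_laplacian]
        ring
    _ = _ := by
        rw [integral_const_mul, ← SchwartzMap.apply_zero_eq_integral_fourier]

theorem iteratedDeriv_even_sphericalSum [Nontrivial (EuclideanSpace ℝ (Fin d))]
    (φ : 𝓢(EuclideanSpace ℝ (Fin d), ℂ)) (m : ℕ) (i : Fin d) :
    iteratedDeriv (2 * m) (sphericalSum φ) 0 = (sphereMoment i m : ℂ) * ((Δ^[m]) φ) 0 := by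
  rw [iteratedDeriv_sphericalSum, sphericalDeriv_even_zero φ m i]

end Moments

/-! ### Cesàro integrals -/

section Cesaro

variable {E : Type*} [NormedAddCommGroup E] [MeasureSpace E]

theorem HasCesaroIntegral.const_mul {g : E → ℂ} {L : ℂ} (hg : HasCesaroIntegral g L) (c : ℂ) :
    HasCesaroIntegral (fun x => c * g x) (c * L) := by
  obtain ⟨h₁, N, h₂⟩ := hg
  refine ⟨fun R => (h₁ R).const_mul c, N, ?_⟩
  refine (h₂.const_mul c).congr fun R => ?_
  rw [← integral_const_mul]
  congr 1
  ext x
  ring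

variable [OpensMeasurableSpace E]

theorem MeasureTheory.IntegrableOn.cesaroWeight_mul {g : E → ℂ} {R : ℝ}
    (hg : IntegrableOn g (Metric.ball 0 R)) (N : ℕ) :
    IntegrableOn (fun x => (((1 - ‖x‖ / R) ^ N : ℝ) : ℂ) * g x) (Metric.ball 0 R) := by
  refine Integrable.bdd_mul (c := 1) hg ?_ ?_
  · exact (Measurable.aestronglyMeasurable (by fun_prop))
  · filter_upwards [ae_restrict_mem measurableSet_ball] with x hx
    rw [mem_ball_zero_iff] at hx
    have hR : 0 < R := (norm_nonneg x).trans_lt hx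
    rw [Complex.norm_real, norm_pow, Real.norm_eq_abs]
    refine pow_le_one₀ (abs_nonneg _) (abs_le.2 ⟨?_, ?_⟩)
    · have := (div_lt_one hR).2 hx
      linarith
    · have : 0 ≤ ‖x‖ / R := by positivity
      linarith

/-- Dominated convergence: the Cesàro weight lies in `[0, 1]` on the ball and tends to `1`
pointwise. Having every order `N` available lets an integrable term be added to a Cesàro integral
without changing its order. -/
theorem MeasureTheory.Integrable.tendsto_cesaro {g : E → ℂ} (hg : Integrable g) (N : ℕ) :
    Tendsto (fun R : ℝ => ∫ x in Metric.ball (0 : E) R, (((1 - ‖x‖ / R) ^ N : ℝ) : ℂ) * g x)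
      atTop (𝓝 (∫ x, g x)) := by
  simp_rw [← integral_indicator (measurableSet_ball (x := (0 : E)))]
  refine tendsto_integral_filter_of_dominated_convergence (fun x => ‖g x‖)
    (Eventually.of_forall fun R => ?_) (Eventually.of_forall fun R => ?_) hg.norm
    (Eventually.of_forall fun x => ?_)
  · exact ((hg.integrableOn.cesaroWeight_mul N).integrable_indicator
      measurableSet_ball).aestronglyMeasurable
  · refine Eventually.of_forall fun x => ?_
    by_cases hx : x ∈ Metric.ball (0 : E) R
    · rw [indicator_of_mem hx, norm_mul]
      rw [mem_ball_zero_iff] at hx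
      have hR : 0 < R := (norm_nonneg x).trans_lt hx
      refine mul_le_of_le_one_left (norm_nonneg _) ?_
      rw [Complex.norm_real, norm_pow, Real.norm_eq_abs]
      refine pow_le_one₀ (abs_nonneg _) (abs_le.2 ⟨?_, ?_⟩)
      · have := (div_lt_one hR).2 hx
        linarith
      · have : 0 ≤ ‖x‖ / R := by positivity
        linarith
    · rw [indicator_of_notMem hx, norm_zero]
      exact norm_nonneg _
  · have h1 : Tendsto (fun R : ℝ => (((1 - ‖x‖ / R) ^ N : ℝ) : ℂ) * g x) atTop (𝓝 (g x)) := by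
      have h : Tendsto (fun R : ℝ => (1 - ‖x‖ / R) ^ N) atTop (𝓝 ((1 - 0) ^ N)) :=
        (tendsto_const_nhds.sub (tendsto_const_nhds.div_atTop tendsto_id)).pow N
      simp only [sub_zero, one_pow] at h
      simpa using ((Complex.continuous_ofReal.tendsto 1).comp h).mul_const (g x)
    refine h1.congr' ?_
    filter_upwards [eventually_gt_atTop ‖x‖] with R hR
    rw [indicator_of_mem (by simpa using hR)]

theorem HasCesaroIntegral.add_integrable {g h : E → ℂ} {L : ℂ} (hg : HasCesaroIntegral g L)
    (hh : Integrable h) : HasCesaroIntegral (fun x => g x + h x) (L + ∫ x, h x) := by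
  obtain ⟨h₁, N, h₂⟩ := hg
  refine ⟨fun R => (h₁ R).add hh.integrableOn, N, ?_⟩
  refine (h₂.add (hh.tendsto_cesaro N)).congr fun R => ?_
  rw [← integral_add ((h₁ R).cesaroWeight_mul N) (hh.integrableOn.cesaroWeight_mul N)]
  simp_rw [mul_add]

theorem MeasureTheory.Integrable.hasCesaroIntegral {g : E → ℂ} (hg : Integrable g) :
    HasCesaroIntegral g (∫ x, g x) :=
  ⟨fun _ => hg.integrableOn, 0, hg.tendsto_cesaro 0⟩

theorem HasCesaroIntegral.eq_integral {g : E → ℂ} {L : ℂ} (h : HasCesaroIntegral g L)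
    (hg : Integrable g) : L = ∫ x, g x := by
  obtain ⟨-, N, h₂⟩ := h
  exact tendsto_nhds_unique h₂ (hg.tendsto_cesaro N)

end Cesaro

/-! ### Dimensional reduction of radial evaluations -/

section Reduction

variable {d : ℕ}

theorem integrableOn_radialAmplitude_mul_taylorSubtract (hd : 1 ≤ d) {k : ℕ} {f w : ℝ → ℂ}
    (h₁ : ∀ R : ℝ, IntegrableOn (fun r : ℝ => f r * (r : ℂ) ^ (d + k)) (Ioc 0 R))
    (h₂ : ∀ R : ℝ, IntegrableOn (fun r : ℝ => f r * (r : ℂ) ^ (d - 1 + k) * (1 - w r)) (Ioc 0 R))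
    (φ : 𝓢(EuclideanSpace ℝ (Fin d), ℂ)) (R : ℝ) :
    IntegrableOn (fun x => radialAmplitude d f x * taylorSubtract (fun y => w ‖y‖) k φ x)
      (Metric.ball 0 R) := by
  -- Removes the truncated subtraction in `d - 1`, so that the Jacobian `r^(d-1)` combines with the
  -- other powers of `r`.
  obtain ⟨e, rfl⟩ : ∃ e, d = e + 1 := ⟨d - 1, by omega⟩
  refine integrable_mul_taylorSubtract (w := fun y => w ‖y‖) ?_ ?_ φ
  · refine (integrableOn_fun_norm_addHaar (volume : Measure (EuclideanSpace ℝ (Fin (e + 1))))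
      (f := fun r => f r * ((r ^ (k + 1) : ℝ) : ℂ))).2 ?_
    refine ((h₁ R).mono_set Ioo_subset_Ioc_self).congr_fun (fun r _ => ?_) measurableSet_Ioo
    simp only [finrank_euclideanSpace, Fintype.card_fin, Complex.real_smul]
    push_cast
    ring
  · refine (integrableOn_fun_norm_addHaar (volume : Measure (EuclideanSpace ℝ (Fin (e + 1))))
      (f := fun r => f r * (1 - w r) * ((r ^ k : ℝ) : ℂ))).2 ?_
    refine ((h₂ R).mono_set Ioo_subset_Ioc_self).congr_fun (fun r _ => ?_) measurableSet_Ioo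
    simp only [finrank_euclideanSpace, Fintype.card_fin, Complex.real_smul]
    push_cast
    ring

theorem integrableOn_reducedAmplitude_mul_taylorSubtract (hd : 1 ≤ d) {k : ℕ} {f w : ℝ → ℂ}
    (h₁ : ∀ R : ℝ, IntegrableOn (fun r : ℝ => f r * (r : ℂ) ^ (d + k)) (Ioc 0 R))
    (h₂ : ∀ R : ℝ, IntegrableOn (fun r : ℝ => f r * (r : ℂ) ^ (d - 1 + k) * (1 - w r)) (Ioc 0 R))
    (ψ : 𝓢(ℝ, ℂ)) (R : ℝ) :
    IntegrableOn (fun r => reducedAmplitude d f r * taylorSubtract (fun s => w ‖s‖) k ψ r)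
      (Metric.ball 0 R) := by
  obtain ⟨e, rfl⟩ : ∃ e, d = e + 1 := ⟨d - 1, by omega⟩
  have hsub : Metric.ball (0 : ℝ) R ∩ Ioi 0 ⊆ Ioc 0 R := fun r hr =>
    ⟨hr.2, (le_abs_self r).trans (mem_ball_zero_iff.1 hr.1).le⟩
  have key : ∀ p q : ℝ → ℂ, IntegrableOn p (Ioc 0 R) → (∀ r, 0 < r → p r = q r) →
      (∀ r, ¬ 0 < r → q r = 0) → IntegrableOn q (Metric.ball (0 : ℝ) R) := by
    intro p q hp h h'
    have hq : q = (Ioi (0 : ℝ)).indicator p := by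
      ext r
      by_cases hr : 0 < r
      · rw [indicator_of_mem (show r ∈ Ioi (0 : ℝ) from hr), h r hr]
      · rw [indicator_of_notMem (show r ∉ Ioi (0 : ℝ) from hr), h' r hr]
    rw [hq, integrableOn_indicator_iff measurableSet_Ioi, inter_comm]
    exact hp.mono_set hsub
  refine integrable_mul_taylorSubtract (w := fun s : ℝ => w ‖s‖) ?_ ?_ ψ
  · refine key _ _ (h₁ R) (fun r hr => ?_) (fun r hr => ?_)
    · rw [reducedAmplitude, indicator_of_mem (show r ∈ Ioi (0 : ℝ) from hr),
        Real.norm_of_nonneg hr.le]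
      push_cast
      ring
    · rw [reducedAmplitude, indicator_of_notMem (show r ∉ Ioi (0 : ℝ) from hr), zero_mul]
  · refine key _ _ (h₂ R) (fun r hr => ?_) (fun r hr => ?_)
    · rw [reducedAmplitude, indicator_of_mem (show r ∈ Ioi (0 : ℝ) from hr),
        Real.norm_of_nonneg hr.le]
      push_cast
      ring
    · rw [reducedAmplitude, indicator_of_notMem (show r ∉ Ioi (0 : ℝ) from hr), zero_mul, zero_mul]

/-- Cesàro means over balls of a radial amplitude against `T_w φ` reduce to the line. -/
theorem cesaroMean_radialAmplitude [Nontrivial (EuclideanSpace ℝ (Fin d))] {k : ℕ} {f w : ℝ → ℂ}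
    {φ : 𝓢(EuclideanSpace ℝ (Fin d), ℂ)} {R : ℝ}
    (hint : IntegrableOn (fun x => radialAmplitude d f x * taylorSubtract (fun y => w ‖y‖) k φ x)
      (Metric.ball 0 R)) (N : ℕ) :
    ∫ x in Metric.ball (0 : EuclideanSpace ℝ (Fin d)) R, (((1 - ‖x‖ / R) ^ N : ℝ) : ℂ) *
        (radialAmplitude d f x * taylorSubtract (fun y => w ‖y‖) k φ x) =
      ∫ r in Metric.ball (0 : ℝ) R, (((1 - ‖r‖ / R) ^ N : ℝ) : ℂ) *
        (reducedAmplitude d f r * taylorSubtract (fun s => w ‖s‖) k (sphericalSum φ) r) := by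
  rw [← integral_indicator measurableSet_ball, ← integral_indicator measurableSet_ball,
    ((integrable_indicator_iff measurableSet_ball).2
      (hint.cesaroWeight_mul N)).integral_eq_integral_sphere,
    ← integral_indicator measurableSet_Ioi]
  congr 1
  ext r
  by_cases hr : 0 < r
  · have hn : ∀ y : Metric.sphere (0 : EuclideanSpace ℝ (Fin d)) 1,
        ‖r • (y : EuclideanSpace ℝ (Fin d))‖ = r := fun y => by
      simp [norm_smul, abs_of_pos hr]
    rw [indicator_of_mem (show r ∈ Ioi (0 : ℝ) from hr)]
    by_cases hR : r < R
    · have hb : r ∈ Metric.ball (0 : ℝ) R := by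
        rw [mem_ball_zero_iff, Real.norm_of_nonneg hr.le]; exact hR
      rw [indicator_of_mem hb, reducedAmplitude,
        indicator_of_mem (show r ∈ Ioi (0 : ℝ) from hr), taylorSubtract_sphericalSum,
        Real.norm_of_nonneg hr.le, ← integral_const_mul, ← integral_const_mul, ← integral_smul]
      refine integral_congr_ae (Eventually.of_forall fun y => ?_)
      simp only []
      rw [indicator_of_mem (by rw [mem_ball_zero_iff, hn]; exact hR), radialAmplitude, hn,
        finrank_euclideanSpace, Fintype.card_fin, Complex.real_smul]
      push_cast
      ring
    · have hb : r ∉ Metric.ball (0 : ℝ) R := by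
        rw [mem_ball_zero_iff, Real.norm_of_nonneg hr.le]; exact hR
      rw [indicator_of_notMem hb]
      have : ∀ y : Metric.sphere (0 : EuclideanSpace ℝ (Fin d)) 1,
          r • (y : EuclideanSpace ℝ (Fin d)) ∉ Metric.ball (0 : EuclideanSpace ℝ (Fin d)) R :=
        fun y => by rw [mem_ball_zero_iff, hn]; exact hR
      simp only [indicator_of_notMem (this _), integral_zero, smul_zero]
  · rw [indicator_of_notMem (show r ∉ Ioi (0 : ℝ) from hr)]
    have : reducedAmplitude d f r = 0 := indicator_of_notMem (show r ∉ Ioi (0 : ℝ) from hr) _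
    by_cases hb : r ∈ Metric.ball (0 : ℝ) R
    · rw [indicator_of_mem hb, this, zero_mul, mul_zero]
    · rw [indicator_of_notMem hb]

/-- Local integrability holds on both sides, and the means are equal for each `R` and `N`; so the
two limit conditions are literally the same. -/
theorem hasCesaroIntegral_radial_iff (hd : 1 ≤ d) {k : ℕ} {f w : ℝ → ℂ}
    (h₁ : ∀ R : ℝ, IntegrableOn (fun r : ℝ => f r * (r : ℂ) ^ (d + k)) (Ioc 0 R))
    (h₂ : ∀ R : ℝ, IntegrableOn (fun r : ℝ => f r * (r : ℂ) ^ (d - 1 + k) * (1 - w r)) (Ioc 0 R))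
    (φ : 𝓢(EuclideanSpace ℝ (Fin d), ℂ)) (L : ℂ) :
    HasCesaroIntegral (fun x : EuclideanSpace ℝ (Fin d) =>
        radialAmplitude d f x * taylorSubtract (fun y => w ‖y‖) k φ x) L ↔
      HasCesaroIntegral (fun r : ℝ =>
        reducedAmplitude d f r * taylorSubtract (fun s => w ‖s‖) k (sphericalSum φ) r) L := by
  have : Nonempty (Fin d) := ⟨⟨0, hd⟩⟩
  have hE := integrableOn_radialAmplitude_mul_taylorSubtract hd h₁ h₂ φ
  have hl := integrableOn_reducedAmplitude_mul_taylorSubtract hd h₁ h₂ (sphericalSumCLM d φ)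
  rw [coe_sphericalSumCLM] at hl
  simp only [HasCesaroIntegral, hE, hl, implies_true, true_and,
    fun R N => cesaroMean_radialAmplitude (hE R) N]

end Reduction

/-! ### Linearity and measurability of `T_w` -/

section Linear

variable {E : Type*} [NormedAddCommGroup E] [NormedSpace ℝ E]

theorem taylorSubtract_add (w : E → ℂ) (k : ℕ) (φ ψ : 𝓢(E, ℂ)) (x : E) :
    taylorSubtract w k (φ + ψ : 𝓢(E, ℂ)) x = taylorSubtract w k φ x + taylorSubtract w k ψ x := by
  simp only [taylorSubtract, taylorPart_add, Finset.sum_add_distrib, add_apply]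
  ring

theorem taylorSubtract_const_smul (w : E → ℂ) (k : ℕ) (c : ℂ) (φ : 𝓢(E, ℂ)) (x : E) :
    taylorSubtract w k (c • φ : 𝓢(E, ℂ)) x = c * taylorSubtract w k φ x := by
  simp only [taylorSubtract, taylorPart_const_smul, ← Finset.mul_sum, smul_apply, smul_eq_mul]
  ring

/-- The evaluation at `x` of the degree `n` part of the Taylor polynomial. -/
def taylorPartCLM (n : ℕ) (x : E) : 𝓢(E, ℂ) →L[ℂ] ℂ :=
  SchwartzMap.mkCLMtoNormedSpace (fun φ => taylorPart φ n x)
    (fun φ ψ => taylorPart_add φ ψ n x) (fun c φ => taylorPart_const_smul c φ n x)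
    ⟨{(0, n)}, ‖x‖ ^ n, by positivity, fun φ => by
      rw [Finset.sup_singleton, mul_comm]
      exact norm_taylorPart_le φ n x⟩

theorem measurable_taylorSubtract [MeasurableSpace E] [BorelSpace E] {w : E → ℂ}
    (hw : Measurable w) (k : ℕ) (φ : 𝓢(E, ℂ)) : Measurable (taylorSubtract w k φ) := by
  unfold taylorSubtract
  refine (φ.continuous.measurable.sub (Finset.measurable_fun_sum _ fun n _ => ?_)).sub (hw.mul ?_)
  · exact (continuous_taylorPart φ n).measurable
  · exact (continuous_taylorPart φ k).measurable

theorem measurable_cutoffWeight (μ : ℝ) : Measurable (cutoffWeight μ) :=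
  Measurable.ite measurableSet_Iic measurable_const measurable_const

end Linear

/-! ### The finite part as a tempered distribution on the line -/

section FinitePart

theorem measurable_inversePower (a : ℕ) : Measurable (inversePower a) := by
  unfold inversePower
  fun_prop

theorem norm_inversePower {a : ℕ} {r : ℝ} (hr : 0 ≤ r) : ‖inversePower a r‖ = (r ^ a)⁻¹ := by
  rw [inversePower, norm_inv, norm_pow, Complex.norm_real, Real.norm_of_nonneg hr]

/-- The integrand `r_+^(-k-1) T_w ψ` for the cutoff weight at `1`. -/
def finitePartIntegrand (k : ℕ) (ψ : ℝ → ℂ) (r : ℝ) : ℂ :=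
  (Ioi (0 : ℝ)).indicator (inversePower (k + 1)) r *
    taylorSubtract (fun s => cutoffWeight 1 ‖s‖) k ψ r

/-- A common bound for the seminorms controlling the finite part. -/
def finitePartSeminorms (k : ℕ) : Finset (ℕ × ℕ) :=
  insert (0, k + 1) (insert (1, 0) ((Finset.range k).image fun n => (0, n)))

/-- The integrable majorant of the integrand defining the finite part. -/
def finitePartMajorant (k : ℕ) (r : ℝ) : ℝ :=
  (Ioc (0 : ℝ) 1).indicator (fun _ => 1) r +
    (Ioi (1 : ℝ)).indicator (fun r => (k + 1) * r ^ (-2 : ℝ)) r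

theorem integrable_finitePartMajorant (k : ℕ) : Integrable (finitePartMajorant k) := by
  refine Integrable.add ?_ ?_
  · exact (integrable_indicator_iff measurableSet_Ioc).2 (integrableOn_const (by simp))
  · exact (integrable_indicator_iff measurableSet_Ioi).2
      ((integrableOn_Ioi_rpow_of_lt (by norm_num) one_pos).const_mul _)

/-- For `r ≤ 1` the Taylor remainder of order `k+1` cancels `r^(-k-1)`. For `r > 1` only `ψ` and the
`k` Taylor parts of degree below `k` remain, each contributing at most a seminorm times `r^(-2)`;
hence the factor `k + 1` in the majorant. -/
theorem norm_finitePartIntegrand_le (k : ℕ) (ψ : 𝓢(ℝ, ℂ)) (r : ℝ) :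
    ‖finitePartIntegrand k ψ r‖ ≤ finitePartMajorant k r *
      ((finitePartSeminorms k).sup (schwartzSeminormFamily ℂ ℝ ℂ)) ψ := by
  set S := ((finitePartSeminorms k).sup (schwartzSeminormFamily ℂ ℝ ℂ)) ψ
  have hS : ∀ m ∈ finitePartSeminorms k, SchwartzMap.seminorm ℂ m.1 m.2 ψ ≤ S := fun m hm =>
    Seminorm.le_def.1 (Finset.le_sup (f := schwartzSeminormFamily ℂ ℝ ℂ) hm) ψ
  unfold finitePartIntegrand finitePartMajorant
  by_cases hr : 0 < r
  swap
  · rw [indicator_of_notMem (show r ∉ Ioi (0 : ℝ) from hr),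
      indicator_of_notMem (fun h : r ∈ Ioc (0 : ℝ) 1 => hr h.1),
      indicator_of_notMem (fun h : r ∈ Ioi (1 : ℝ) => hr (one_pos.trans h))]
    simp
  rw [indicator_of_mem (show r ∈ Ioi (0 : ℝ) from hr), norm_mul, norm_inversePower hr.le]
  by_cases h1 : r ≤ 1
  · rw [indicator_of_mem (show r ∈ Ioc (0 : ℝ) 1 from ⟨hr, h1⟩),
      indicator_of_notMem (show r ∉ Ioi (1 : ℝ) from not_lt.2 h1), add_zero, one_mul,
      taylorSubtract_eq]
    have hc : cutoffWeight 1 ‖r‖ = 1 := by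
      rw [Real.norm_of_nonneg hr.le, cutoffWeight, if_pos (by simpa using h1)]
    rw [hc, sub_self, zero_mul, add_zero, inv_mul_le_iff₀ (by positivity), mul_comm]
    refine (norm_sub_taylor_le ψ k r).trans ?_
    rw [Real.norm_of_nonneg hr.le]
    gcongr
    exact hS (0, k + 1) (by simp [finitePartSeminorms])
  · push Not at h1
    rw [indicator_of_notMem (fun h : r ∈ Ioc (0 : ℝ) 1 => h1.not_ge h.2),
      indicator_of_mem (show r ∈ Ioi (1 : ℝ) from h1), zero_add, taylorSubtract]
    have hc : cutoffWeight 1 ‖r‖ = 0 := by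
      rw [Real.norm_of_nonneg hr.le, cutoffWeight, if_neg (by simpa using h1)]
    rw [hc, zero_mul, sub_zero]
    have hr2 : r ^ (-2 : ℝ) = (r ^ 2)⁻¹ := by
      rw [Real.rpow_neg hr.le]; norm_cast
    rw [hr2]
    have hψ : ‖ψ r‖ ≤ S * r⁻¹ := by
      rw [← div_eq_mul_inv, le_div_iff₀ hr, mul_comm]
      have := (ψ.norm_pow_mul_le_seminorm ℂ 1 r).trans (hS (1, 0) (by simp [finitePartSeminorms]))
      rwa [pow_one, Real.norm_of_nonneg hr.le] at this
    have hS0 : 0 ≤ S := apply_nonneg _ _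
    have hn : ∀ n ∈ Finset.range k, ‖taylorPart ψ n r‖ ≤ S * r ^ (k - 1) := fun n hn => by
      refine (norm_taylorPart_le ψ n r).trans ?_
      rw [Real.norm_of_nonneg hr.le]
      have hn' := Finset.mem_range.1 hn
      gcongr
      · exact hS (0, n) (by simp [finitePartSeminorms, hn'])
      · exact h1.le
      · omega
    have hp : (r ^ (k + 1))⁻¹ * r⁻¹ ≤ (r ^ 2)⁻¹ := by
      rw [← mul_inv, ← pow_succ]
      gcongr
      exacts [h1.le, by omega]
    -- The factor `j` saves the case `j = 0`, where `j - 1` truncates to `0`.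
    have hq : ∀ j : ℕ, (j : ℝ) * ((r ^ (j + 1))⁻¹ * r ^ (j - 1)) = j * (r ^ 2)⁻¹ := by
      rintro (_ | j)
      · simp
      · simp only [Nat.add_sub_cancel]
        field_simp
        ring
    calc (r ^ (k + 1))⁻¹ * ‖ψ r - ∑ n ∈ Finset.range k, taylorPart ψ n r‖
        ≤ (r ^ (k + 1))⁻¹ * (S * r⁻¹ + ∑ n ∈ Finset.range k, S * r ^ (k - 1)) := by
          gcongr
          refine (norm_sub_le _ _).trans (add_le_add hψ ?_)
          exact (norm_sum_le _ _).trans (Finset.sum_le_sum hn)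
      _ = S * ((r ^ (k + 1))⁻¹ * r⁻¹) + S * (k * ((r ^ (k + 1))⁻¹ * r ^ (k - 1))) := by
          rw [Finset.sum_const, Finset.card_range, nsmul_eq_mul]
          ring
      _ ≤ S * (r ^ 2)⁻¹ + S * (k * (r ^ 2)⁻¹) := by
          rw [hq]
          gcongr
      _ = (k + 1) * (r ^ 2)⁻¹ * S := by ring

theorem measurable_finitePartIntegrand (k : ℕ) (ψ : 𝓢(ℝ, ℂ)) :
    Measurable (finitePartIntegrand k ψ) :=
  ((measurable_inversePower _).indicator measurableSet_Ioi).mul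
    (measurable_taylorSubtract ((measurable_cutoffWeight 1).comp measurable_norm) k ψ)

theorem integrable_finitePartIntegrand (k : ℕ) (ψ : 𝓢(ℝ, ℂ)) :
    Integrable (finitePartIntegrand k ψ) :=
  ((integrable_finitePartMajorant k).mul_const _).mono'
    (measurable_finitePartIntegrand k ψ).aestronglyMeasurable
    (Eventually.of_forall (norm_finitePartIntegrand_le k ψ))

/-- The Hadamard finite part of `r_+^(-k-1)`. -/
def finitePart (k : ℕ) : 𝓢(ℝ, ℂ) →L[ℂ] ℂ :=
  SchwartzMap.mkCLMtoNormedSpace (fun ψ => ∫ r, finitePartIntegrand k ψ r)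
    (fun φ ψ => by
      rw [← integral_add (integrable_finitePartIntegrand k φ) (integrable_finitePartIntegrand k ψ)]
      simp only [finitePartIntegrand, taylorSubtract_add, mul_add])
    (fun c ψ => by
      rw [RingHom.id_apply, smul_eq_mul, ← integral_const_mul]
      simp only [finitePartIntegrand, taylorSubtract_const_smul, mul_left_comm])
    ⟨finitePartSeminorms k, ∫ r, finitePartMajorant k r, integral_nonneg fun r =>
      add_nonneg (indicator_nonneg (fun _ _ => zero_le_one) _)
        (indicator_nonneg (fun r hr => by
          have : 0 < r := one_pos.trans hr
          positivity) _), fun ψ => by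
      rw [← integral_mul_const]
      exact norm_integral_le_of_norm_le ((integrable_finitePartMajorant k).mul_const _)
        (Eventually.of_forall (norm_finitePartIntegrand_le k ψ))⟩

theorem finitePart_apply (k : ℕ) (ψ : 𝓢(ℝ, ℂ)) :
    finitePart k ψ = ∫ r, finitePartIntegrand k ψ r := rfl

end FinitePart

/-! ### Identification with the Hadamard finite part -/

section Pseudofunction

theorem integrableOn_and_integral_Ioi_inv_pow {ε : ℝ} (hε : 0 < ε) {j : ℕ} (hj : 0 < j) :
    IntegrableOn (fun r : ℝ => ((r : ℂ) ^ (j + 1))⁻¹) (Ioi ε) ∧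
      ∫ r in Ioi ε, ((r : ℂ) ^ (j + 1))⁻¹ = ((ε : ℂ) ^ j)⁻¹ / j := by
  have hj' : (0 : ℝ) < j := by exact_mod_cast hj
  have e : ∀ r : ℝ, ((r : ℂ) ^ (j + 1))⁻¹ = (r : ℂ) ^ (-((j + 1 : ℕ) : ℂ)) := fun r => by
    rw [Complex.cpow_neg, Complex.cpow_natCast]
  have hre : (-((j + 1 : ℕ) : ℂ)).re < -1 := by
    simp only [Complex.neg_re, Complex.natCast_re]
    push_cast
    linarith
  simp_rw [e]
  refine ⟨integrableOn_Ioi_cpow_of_lt hre hε, ?_⟩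
  rw [integral_Ioi_cpow_of_lt hre hε]
  have : (-((j + 1 : ℕ) : ℂ)) + 1 = -(j : ℂ) := by push_cast; ring
  rw [this, Complex.cpow_neg, Complex.cpow_natCast, neg_div_neg_eq]

theorem integral_Ioc_inv {ε : ℝ} (hε : 0 < ε) (h1 : ε ≤ 1) :
    ∫ r in Ioc ε 1, (r : ℂ)⁻¹ = -(Real.log ε : ℂ) := by
  have : ∀ r : ℝ, (r : ℂ)⁻¹ = ((r⁻¹ : ℝ) : ℂ) := fun r => by push_cast; rfl
  simp_rw [this]
  rw [integral_complex_ofReal, ← intervalIntegral.integral_of_le h1, integral_inv_of_pos hε one_pos,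
    one_div, Real.log_inv]
  push_cast
  rfl

theorem integrableOn_Ioc_inv {ε : ℝ} (hε : 0 < ε) (b : ℝ) :
    IntegrableOn (fun r : ℝ => (r : ℂ)⁻¹) (Ioc ε b) := by
  refine (ContinuousOn.integrableOn_Icc ?_).mono_set Ioc_subset_Icc_self
  refine Complex.continuous_ofReal.continuousOn.inv₀ fun r hr => ?_
  exact_mod_cast (hε.trans_le hr.1).ne'

/-- Regularisation of the divergent integral of `ψ(r) r^(-k-1)` by means of the finite part. -/
theorem integral_Ioi_div_pow_eq (k : ℕ) (ψ : 𝓢(ℝ, ℂ)) {ε : ℝ} (hε : 0 < ε) (h1 : ε ≤ 1) :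
    ∫ r in Ioi ε, ψ r / (r : ℂ) ^ (k + 1) = (∫ r in Ioi ε, finitePartIntegrand k ψ r)
      + ∑ n ∈ Finset.range k, taylorPart ψ n 1 * (((ε : ℂ) ^ (k - n))⁻¹ / (k - n : ℕ))
      - taylorPart ψ k 1 * (Real.log ε : ℂ) := by
  have ht : ∀ n (r : ℝ), taylorPart ψ n r = taylorPart ψ n 1 * (r : ℂ) ^ n := fun n r => by
    have := taylorPart_smul ψ n r 1
    rw [smul_eq_mul, mul_one] at this
    rw [this, mul_comm]
  -- The Taylor parts removed by the cutoff are restored: degree `n < k` on the whole ray, giving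
  -- powers of `ε`, and degree `k` only up to `1`, giving the logarithm.
  have e : ∀ r ∈ Ioi ε, ψ r / (r : ℂ) ^ (k + 1) = finitePartIntegrand k ψ r
      + ∑ n ∈ Finset.range k, taylorPart ψ n 1 * ((r : ℂ) ^ (k - n + 1))⁻¹
      + taylorPart ψ k 1 * (Ioc ε 1).indicator (fun r : ℝ => (r : ℂ)⁻¹) r := by
    intro r hr
    have hr0 : 0 < r := hε.trans hr
    have hrc : (r : ℂ) ≠ 0 := by exact_mod_cast hr0.ne'
    have hs : ∑ n ∈ Finset.range k, taylorPart ψ n 1 * ((r : ℂ) ^ (k - n + 1))⁻¹ =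
        ((r : ℂ) ^ (k + 1))⁻¹ * ∑ n ∈ Finset.range k, taylorPart ψ n r := by
      rw [Finset.mul_sum]
      refine Finset.sum_congr rfl fun n hn => ?_
      have hn' := Finset.mem_range.1 hn
      have : k + 1 = (k - n + 1) + n := by omega
      rw [ht n r, this, pow_add]
      field_simp
      ring
    have hi : (Ioc ε 1).indicator (fun r : ℝ => (r : ℂ)⁻¹) r = cutoffWeight 1 ‖r‖ * (r : ℂ)⁻¹ := by
      rw [Real.norm_of_nonneg hr0.le, cutoffWeight, inv_one]
      by_cases h : r ≤ 1
      · rw [indicator_of_mem (show r ∈ Ioc ε 1 from ⟨hr, h⟩), if_pos h, one_mul]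
      · rw [indicator_of_notMem (fun h' : r ∈ Ioc ε 1 => h h'.2), if_neg h, zero_mul]
    rw [hs, hi, finitePartIntegrand, indicator_of_mem (show r ∈ Ioi (0 : ℝ) from hr0),
      inversePower, taylorSubtract, ht k r]
    field_simp
    ring
  have i1 : IntegrableOn (finitePartIntegrand k ψ) (Ioi ε) :=
    (integrable_finitePartIntegrand k ψ).integrableOn
  have i2 : ∀ n ∈ Finset.range k, Integrable
      (fun r : ℝ => taylorPart ψ n 1 * ((r : ℂ) ^ (k - n + 1))⁻¹) (volume.restrict (Ioi ε)) :=
    fun n hn => (integrableOn_and_integral_Ioi_inv_pow hε (by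
      have := Finset.mem_range.1 hn; omega)).1.const_mul _
  have i3 : IntegrableOn (fun r => taylorPart ψ k 1 *
      (Ioc ε 1).indicator (fun r : ℝ => (r : ℂ)⁻¹) r) (Ioi ε) :=
    (((integrable_indicator_iff measurableSet_Ioc).2
      (integrableOn_Ioc_inv hε 1)).const_mul _).integrableOn
  have s2 := integrable_finsetSum _ i2
  have e₁ := integral_add (i1.add s2) i3
  have e₂ := integral_add i1 s2
  simp only [Pi.add_apply] at e₁ e₂
  rw [setIntegral_congr_fun measurableSet_Ioi e, e₁, e₂,
    integral_finsetSum _ i2, integral_const_mul, setIntegral_indicator measurableSet_Ioc,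
    inter_eq_self_of_subset_right Ioc_subset_Ioi_self, integral_Ioc_inv hε h1]
  have : ∀ n ∈ Finset.range k, ∫ r in Ioi ε, taylorPart ψ n 1 * ((r : ℂ) ^ (k - n + 1))⁻¹ =
      taylorPart ψ n 1 * (((ε : ℂ) ^ (k - n))⁻¹ / (k - n : ℕ)) := fun n hn => by
    rw [integral_const_mul, (integrableOn_and_integral_Ioi_inv_pow hε (by
      have := Finset.mem_range.1 hn; omega)).2]
  rw [Finset.sum_congr rfl this]
  ring

theorem tendsto_integral_Ioi_finitePartIntegrand (k : ℕ) (ψ : 𝓢(ℝ, ℂ)) :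
    Tendsto (fun ε : ℝ => ∫ r in Ioi ε, finitePartIntegrand k ψ r) (𝓝[>] 0)
      (𝓝 (finitePart k ψ)) := by
  have hs : ∫ r in Ioi (0 : ℝ), finitePartIntegrand k ψ r = finitePart k ψ := by
    rw [finitePart_apply]
    refine setIntegral_eq_integral_of_forall_compl_eq_zero fun r hr => ?_
    rw [finitePartIntegrand, indicator_of_notMem hr, zero_mul]
  have h := (aecover_Ioi_of_Ioi (μ := (volume : Measure ℝ)) (a := fun ε : ℝ => ε)
    (l := 𝓝[>] (0 : ℝ)) (A := 0) (tendsto_id.mono_left nhdsWithin_le_nhds)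
    ).integral_tendsto_of_countably_generated
    (integrable_finitePartIntegrand k ψ).integrableOn
  rw [hs] at h
  refine h.congr' ?_
  filter_upwards [self_mem_nhdsWithin] with ε hε
  rw [Measure.restrict_restrict measurableSet_Ioi,
    inter_eq_self_of_subset_left (Ioi_subset_Ioi (le_of_lt hε))]

theorem isPseudofunction_finitePart (k : ℕ) :
    IsPseudofunction (k + 1)
      (ContinuousLinearMap.toPointwiseConvergenceCLM _ _ _ _ (finitePart k)) := by
  intro ψ
  -- The discarded exponents are `θ = k - n` with `n < k`. Coefficients must be functions of `θ`, so
  -- the degree is recovered as `n = k - ⌊θ.re⌋₊`.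
  refine ⟨(Finset.range k).image fun n => ((k - n : ℕ) : ℂ),
    fun θ => taylorPart ψ (k - ⌊θ.re⌋₊) 1 / θ, -taylorPart ψ k 1, ?_, ?_⟩
  · simp only [Finset.mem_image, Finset.mem_range]
    rintro _ ⟨n, hn, rfl⟩
    refine ⟨?_, ?_⟩
    · exact_mod_cast (by omega : k - n ≠ 0)
    · rw [Complex.natCast_re]
      positivity
  · refine (tendsto_integral_Ioi_finitePartIntegrand k ψ).congr' ?_
    filter_upwards [Ioc_mem_nhdsGT (zero_lt_one' ℝ)] with ε hε
    rw [integral_Ioi_div_pow_eq k ψ hε.1 hε.2, Finset.sum_image]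
    · have : ∀ n ∈ Finset.range k, taylorPart ψ (k - ⌊((k - n : ℕ) : ℂ).re⌋₊) 1 /
          ((k - n : ℕ) : ℂ) * (ε : ℂ) ^ (-((k - n : ℕ) : ℂ)) =
          taylorPart ψ n 1 * (((ε : ℂ) ^ (k - n))⁻¹ / (k - n : ℕ)) := by
        intro n hn
        have hn' := Finset.mem_range.1 hn
        rw [Complex.natCast_re, Nat.floor_natCast, Complex.cpow_neg, Complex.cpow_natCast,
          Nat.sub_sub_self hn'.le]
        ring
      rw [Finset.sum_congr rfl this]
      ring
    · intro a ha b hb hab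
      have ha' := Finset.mem_range.1 ha
      have hb' := Finset.mem_range.1 hb
      have : k - a = k - b := Nat.cast_injective hab
      omega

end Pseudofunction

/-! ### Change of weight on the line -/

section Weights

theorem taylorSubtract_weight_sub {E : Type*} [NormedAddCommGroup E] [NormedSpace ℝ E]
    (w v : E → ℂ) (k : ℕ) (φ : E → ℂ) (x : E) :
    taylorSubtract w k φ x = taylorSubtract v k φ x + (v x - w x) * taylorPart φ k x := by
  simp only [taylorSubtract]
  ring

theorem reducedAmplitude_inversePower {d : ℕ} (hd : 1 ≤ d) (k : ℕ) :
    reducedAmplitude d (inversePower (d + k)) = (Ioi (0 : ℝ)).indicator (inversePower (k + 1)) := by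
  ext r
  unfold reducedAmplitude
  by_cases hr : 0 < r
  · rw [indicator_of_mem (show r ∈ Ioi (0 : ℝ) from hr),
      indicator_of_mem (show r ∈ Ioi (0 : ℝ) from hr)]
    have hrc : (r : ℂ) ≠ 0 := by exact_mod_cast hr.ne'
    have : d + k = (d - 1) + (k + 1) := by omega
    rw [inversePower, inversePower, this, pow_add]
    field_simp
  · rw [indicator_of_notMem (show r ∉ Ioi (0 : ℝ) from hr),
      indicator_of_notMem (show r ∉ Ioi (0 : ℝ) from hr)]

/-- The passage from the cutoff weight at `1` to a general weight. -/
theorem indicator_inversePower_mul_taylorSubtract (k : ℕ) (w : ℝ → ℂ) (ψ : ℝ → ℂ) (r : ℝ) :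
    (Ioi (0 : ℝ)).indicator (inversePower (k + 1)) r * taylorSubtract (fun s => w ‖s‖) k ψ r =
      taylorPart ψ k 1 * ((Ioc (0 : ℝ) 1).indicator (fun r : ℝ => (1 - w r) / (r : ℂ)) r
        - (Ioi (1 : ℝ)).indicator (fun r : ℝ => w r / (r : ℂ)) r)
      + finitePartIntegrand k ψ r := by
  by_cases hr : 0 < r
  · have hrc : (r : ℂ) ≠ 0 := by exact_mod_cast hr.ne'
    -- The difference of the two weights is split at `1`, matching the two hypotheses on `w`:
    -- absolute integrability near `0` and a Cesàro tail.
    have hw : (Ioc (0 : ℝ) 1).indicator (fun r : ℝ => (1 - w r) / (r : ℂ)) r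
        - (Ioi (1 : ℝ)).indicator (fun r : ℝ => w r / (r : ℂ)) r =
        (cutoffWeight 1 ‖r‖ - w ‖r‖) / r := by
      rw [Real.norm_of_nonneg hr.le, cutoffWeight, inv_one]
      by_cases h : r ≤ 1
      · rw [indicator_of_mem (show r ∈ Ioc (0 : ℝ) 1 from ⟨hr, h⟩), if_pos h,
          indicator_of_notMem (show r ∉ Ioi (1 : ℝ) from not_lt.2 h), sub_zero]
      · rw [indicator_of_notMem (fun h' : r ∈ Ioc (0 : ℝ) 1 => h h'.2), if_neg h,
          indicator_of_mem (show r ∈ Ioi (1 : ℝ) from not_le.1 h)]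
        ring
    have ht := taylorPart_smul ψ k r 1
    rw [smul_eq_mul, mul_one] at ht
    rw [hw, finitePartIntegrand, indicator_of_mem (show r ∈ Ioi (0 : ℝ) from hr), inversePower,
      taylorSubtract_weight_sub (fun s => w ‖s‖) (fun s => cutoffWeight 1 ‖s‖), ht]
    field_simp
    ring
  · rw [finitePartIntegrand, indicator_of_notMem (show r ∉ Ioi (0 : ℝ) from hr),
      indicator_of_notMem (fun h : r ∈ Ioc (0 : ℝ) 1 => hr h.1),
      indicator_of_notMem (fun h : r ∈ Ioi (1 : ℝ) => hr (one_pos.trans h))]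
    simp

/-- The extension `T_w (r_+^(-k-1))` differs from the finite part by a multiple of `δ^(k)`. -/
theorem IsRadialWeight.hasCesaroIntegral {w : ℝ → ℂ} (hw : IsRadialWeight w) :
    ∃ c : ℂ, ∀ (k : ℕ) (ψ : 𝓢(ℝ, ℂ)), HasCesaroIntegral
      (fun r => (Ioi (0 : ℝ)).indicator (inversePower (k + 1)) r *
        taylorSubtract (fun s => w ‖s‖) k ψ r) (finitePart k ψ + c * taylorPart ψ k 1) := by
  obtain ⟨W, hW⟩ := hw.cesaro_tail
  have hi := (integrable_indicator_iff measurableSet_Ioc).2 (hw.integrable_near_zero 1)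
  -- The constant does not depend on `k` or `ψ`. Only the tail `W` is a genuine Cesàro value; the
  -- other terms converge absolutely.
  refine ⟨-1 * W + ∫ r, (Ioc (0 : ℝ) 1).indicator (fun r : ℝ => (1 - w r) / (r : ℂ)) r,
    fun k ψ => ?_⟩
  have h := (((hW.const_mul (-1)).add_integrable hi).const_mul (taylorPart ψ k 1)).add_integrable
    (integrable_finitePartIntegrand k ψ)
  rw [← finitePart_apply] at h
  simp_rw [indicator_inversePower_mul_taylorSubtract]
  convert h using 1
  · ext r; ring
  · ring

theorem integrable_and_integral_cutoffWeight_sub {μ : ℝ} (hμ : 0 < μ) :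
    Integrable (fun r : ℝ => (Ioc (0 : ℝ) 1).indicator
        (fun r : ℝ => (1 - cutoffWeight μ r) / (r : ℂ)) r
        - (Ioi (1 : ℝ)).indicator (fun r : ℝ => cutoffWeight μ r / (r : ℂ)) r) ∧
      ∫ r : ℝ, ((Ioc (0 : ℝ) 1).indicator (fun r : ℝ => (1 - cutoffWeight μ r) / (r : ℂ)) r
        - (Ioi (1 : ℝ)).indicator (fun r : ℝ => cutoffWeight μ r / (r : ℂ)) r) = Real.log μ := by
  have hμ' : 0 < μ⁻¹ := inv_pos.2 hμ
  have e₁ : (Ioc (0 : ℝ) 1).indicator (fun r : ℝ => (1 - cutoffWeight μ r) / (r : ℂ)) =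
      (Ioc μ⁻¹ 1).indicator (fun r : ℝ => (r : ℂ)⁻¹) := by
    ext r
    simp only [indicator_apply, mem_Ioc, cutoffWeight]
    by_cases h : r ≤ μ⁻¹
    · simp [h, not_lt.2 h]
    · simp [h, not_le.1 h, hμ'.trans (not_le.1 h), one_div]
  have e₂ : (Ioi (1 : ℝ)).indicator (fun r : ℝ => cutoffWeight μ r / (r : ℂ)) =
      (Ioc 1 μ⁻¹).indicator (fun r : ℝ => (r : ℂ)⁻¹) := by
    ext r
    simp only [indicator_apply, mem_Ioc, mem_Ioi, cutoffWeight]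
    by_cases h : r ≤ μ⁻¹
    · simp [h, one_div]
    · simp [h]
  rw [e₁, e₂]
  have i₁ := (integrable_indicator_iff measurableSet_Ioc).2 (integrableOn_Ioc_inv hμ' 1)
  have i₂ := (integrable_indicator_iff measurableSet_Ioc).2
    (integrableOn_Ioc_inv one_pos μ⁻¹)
  refine ⟨i₁.sub i₂, ?_⟩
  rw [integral_sub i₁ i₂, integral_indicator measurableSet_Ioc,
    integral_indicator measurableSet_Ioc]
  -- The difference of the two set integrals is by definition the oriented integral from `μ⁻¹` to
  -- `1`, so `μ ≤ 1` and `μ ≥ 1` need no separate treatment.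
  change ∫ r in μ⁻¹..1, (r : ℂ)⁻¹ = _
  have : ∀ r : ℝ, (r : ℂ)⁻¹ = ((r⁻¹ : ℝ) : ℂ) := fun r => by push_cast; rfl
  simp_rw [this]
  rw [intervalIntegral.integral_ofReal, integral_inv_of_pos hμ' one_pos, one_div, inv_inv]

theorem integrable_indicator_mul_taylorSubtract_cutoff {μ : ℝ} (hμ : 0 < μ) (k : ℕ)
    (ψ : 𝓢(ℝ, ℂ)) :
    Integrable (fun r => (Ioi (0 : ℝ)).indicator (inversePower (k + 1)) r *
      taylorSubtract (fun s => cutoffWeight μ ‖s‖) k ψ r) := by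
  simp_rw [indicator_inversePower_mul_taylorSubtract]
  exact ((integrable_and_integral_cutoffWeight_sub hμ).1.const_mul _).add
    (integrable_finitePartIntegrand k ψ)

theorem integral_indicator_mul_taylorSubtract_cutoff {μ : ℝ} (hμ : 0 < μ) (k : ℕ)
    (ψ : 𝓢(ℝ, ℂ)) :
    ∫ r, (Ioi (0 : ℝ)).indicator (inversePower (k + 1)) r *
      taylorSubtract (fun s => cutoffWeight μ ‖s‖) k ψ r =
      finitePart k ψ + Real.log μ * taylorPart ψ k 1 := by
  simp_rw [indicator_inversePower_mul_taylorSubtract]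
  rw [integral_add ((integrable_and_integral_cutoffWeight_sub hμ).1.const_mul _)
    (integrable_finitePartIntegrand k ψ), integral_const_mul,
    (integrable_and_integral_cutoffWeight_sub hμ).2, finitePart_apply]
  ring

theorem isRadialWeight_cutoffWeight {μ : ℝ} (hμ : 0 < μ) : IsRadialWeight (cutoffWeight μ) := by
  have hμ' : 0 < μ⁻¹ := inv_pos.2 hμ
  refine ⟨by simp [cutoffWeight, hμ.le], fun R => ?_, ?_⟩
  · refine ((integrable_indicator_iff measurableSet_Ioc).2
      (integrableOn_Ioc_inv hμ' R)).integrableOn.congr_fun (fun r hr => ?_) measurableSet_Ioc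
    simp only [indicator_apply, mem_Ioc, cutoffWeight]
    by_cases h : r ≤ μ⁻¹
    · simp [h, not_lt.2 h]
    · simp [h, not_le.1 h, hr.2, one_div]
  · refine ⟨_, Integrable.hasCesaroIntegral ((integrable_indicator_iff measurableSet_Ioi).2
      (((integrable_indicator_iff measurableSet_Ioc).2
        (integrableOn_Ioc_inv one_pos μ⁻¹)).integrableOn.congr_fun (fun r hr => ?_)
        measurableSet_Ioi))⟩
    have h1 : 1 < r := hr
    simp only [indicator_apply, mem_Ioc, cutoffWeight]
    by_cases h : r ≤ μ⁻¹
    · simp [h, h1, one_div]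
    · simp [h]

end Weights

/-! ### Extensions of inverse powers and comparison with the finite part -/

section Extension

/-- Flatness makes the Taylor remainder equal to `φ`, so `φ` is of size `‖x‖^(a+1)` near the origin
and absorbs the singularity; outside the unit ball `F` is bounded by `1`. -/
theorem integrable_mul_of_flat {E : Type*} [NormedAddCommGroup E] [NormedSpace ℝ E]
    [MeasureSpace E] [BorelSpace E] [FiniteDimensional ℝ E]
    [(volume : Measure E).IsAddHaarMeasure] {F : E → ℂ} {a : ℕ} (hF : Measurable F)
    (hFa : ∀ x, ‖F x‖ ≤ (‖x‖ ^ a)⁻¹) (φ : 𝓢(E, ℂ)) (hφ : ∀ n : ℕ, iteratedFDeriv ℝ n φ 0 = 0) :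
    Integrable (fun x => F x * φ x) := by
  set C := SchwartzMap.seminorm ℂ 0 (a + 1) φ
  have hC : ∀ x, ‖φ x‖ ≤ C * ‖x‖ ^ (a + 1) := fun x => by
    simpa [taylorPart, hφ] using norm_sub_taylor_le φ a x
  have hC0 : 0 ≤ C := apply_nonneg _ _
  have hb : Integrable (fun x : E => (Metric.ball (0 : E) 1).indicator (fun _ => C) x + ‖φ x‖) :=
    ((integrable_indicator_iff measurableSet_ball).2
      (integrableOn_const measure_ball_lt_top.ne)).add φ.integrable.norm
  refine hb.mono' (hF.mul φ.continuous.measurable).aestronglyMeasurable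
    (Eventually.of_forall fun x => ?_)
  rw [norm_mul]
  by_cases hx : x ∈ Metric.ball (0 : E) 1
  · rw [indicator_of_mem hx]
    rw [mem_ball_zero_iff] at hx
    refine le_add_of_le_of_nonneg ?_ (norm_nonneg _)
    calc ‖F x‖ * ‖φ x‖ ≤ (‖x‖ ^ a)⁻¹ * (C * ‖x‖ ^ (a + 1)) := by
          gcongr
          exacts [hFa x, hC x]
      _ ≤ C := by
          rcases (norm_nonneg x).eq_or_lt with h | h
          · simp [← h, hC0]
          · rw [pow_succ]
            have : (‖x‖ ^ a)⁻¹ * (C * (‖x‖ ^ a * ‖x‖)) = C * ‖x‖ := by field_simp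
            rw [this]
            exact mul_le_of_le_one_right hC0 hx.le
  · rw [indicator_of_notMem hx, zero_add]
    rw [mem_ball_zero_iff, not_lt] at hx
    refine mul_le_of_le_one_left (norm_nonneg _) ((hFa x).trans ?_)
    exact inv_le_one_of_one_le₀ (one_le_pow₀ hx)

/-- `T_w φ = φ` when all derivatives vanish at `0`, and a Cesàro value of an integrable function is
its integral. -/
theorem IsWeightedExtension.isExtensionOf {E : Type*} [NormedAddCommGroup E] [NormedSpace ℝ E]
    [MeasureSpace E] [BorelSpace E] [FiniteDimensional ℝ E]
    [(volume : Measure E).IsAddHaarMeasure] {F w : E → ℂ} {k a : ℕ} {T : 𝓢'(E, ℂ)}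
    (hT : IsWeightedExtension F w k T) (hF : Measurable F)
    (hFa : ∀ x, ‖F x‖ ≤ (‖x‖ ^ a)⁻¹) : IsExtensionOf F T := by
  intro φ hφ
  have hi := integrable_mul_of_flat hF hFa φ hφ
  refine ⟨hi, HasCesaroIntegral.eq_integral ?_ hi⟩
  simpa [taylorSubtract, taylorPart, hφ] using hT φ

theorem IsWeightedExtension.isCutoffExtension {E : Type*} [NormedAddCommGroup E] [NormedSpace ℝ E]
    [MeasureSpace E] [OpensMeasurableSpace E] {F : E → ℂ} {μ : ℝ} {k : ℕ} {T : 𝓢'(E, ℂ)}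
    (hT : IsWeightedExtension F (fun x => cutoffWeight μ ‖x‖) k T)
    (hi : ∀ φ : 𝓢(E, ℂ),
      Integrable fun x => F x * taylorSubtract (fun y => cutoffWeight μ ‖y‖) k φ x) :
    IsCutoffExtension F μ k T :=
  fun φ => ⟨hi φ, (hT φ).eq_integral (hi φ)⟩

theorem norm_radialAmplitude_inversePower (d a : ℕ) (x : EuclideanSpace ℝ (Fin d)) :
    ‖radialAmplitude d (inversePower a) x‖ = (‖x‖ ^ a)⁻¹ :=
  norm_inversePower (norm_nonneg x)

theorem measurable_radialAmplitude_inversePower (d a : ℕ) :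
    Measurable (radialAmplitude d (inversePower a)) :=
  (measurable_inversePower a).comp measurable_norm

theorem norm_indicator_inversePower_le (a : ℕ) (r : ℝ) :
    ‖(Ioi (0 : ℝ)).indicator (inversePower a) r‖ ≤ (‖r‖ ^ a)⁻¹ := by
  by_cases hr : 0 < r
  · rw [indicator_of_mem (show r ∈ Ioi (0 : ℝ) from hr), norm_inversePower hr.le,
      Real.norm_of_nonneg hr.le]
  · rw [indicator_of_notMem (show r ∉ Ioi (0 : ℝ) from hr), norm_zero]
    positivity

theorem integrableOn_inversePower_mul_pow (a : ℕ) (R : ℝ) :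
    IntegrableOn (fun r : ℝ => inversePower a r * (r : ℂ) ^ a) (Ioc 0 R) := by
  refine (integrableOn_const (C := (1 : ℂ)) (by simp)).congr_fun (fun r hr => ?_) measurableSet_Ioc
  have : (r : ℂ) ≠ 0 := by exact_mod_cast hr.1.ne'
  simp [inversePower, this]

theorem IsRadialWeight.integrableOn_inversePower_mul {w : ℝ → ℂ} (hw : IsRadialWeight w) {d : ℕ}
    (hd : 1 ≤ d) (k : ℕ) (R : ℝ) :
    IntegrableOn (fun r : ℝ => inversePower (d + k) r * (r : ℂ) ^ (d - 1 + k) * (1 - w r))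
      (Ioc 0 R) := by
  refine (hw.integrable_near_zero R).congr_fun (fun r hr => ?_) measurableSet_Ioc
  have hr0 : (r : ℂ) ≠ 0 := by exact_mod_cast hr.1.ne'
  have : d + k = (d - 1 + k) + 1 := by omega
  rw [inversePower, this, pow_succ]
  field_simp

variable {d : ℕ}

theorem integrable_radialAmplitude_mul_taylorSubtract_cutoff (hd : 1 ≤ d) {μ : ℝ} (hμ : 0 < μ)
    (k : ℕ) (φ : 𝓢(EuclideanSpace ℝ (Fin d), ℂ)) :
    Integrable (fun x => radialAmplitude d (inversePower (d + k)) x *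
      taylorSubtract (fun y => cutoffWeight μ ‖y‖) k φ x) := by
  -- Outside this radius both `‖x‖ ≥ 1` and `‖x‖ > μ⁻¹`: the weight vanishes and the remaining
  -- Taylor parts, of degree below `k`, decay at least like `‖x‖^(-d-1)`.
  set R : ℝ := 1 + μ⁻¹
  have hμ' : 0 < μ⁻¹ := inv_pos.2 hμ
  have hloc := integrableOn_radialAmplitude_mul_taylorSubtract hd
    (integrableOn_inversePower_mul_pow (d + k))
    ((isRadialWeight_cutoffWeight hμ).integrableOn_inversePower_mul hd k) φ R
  set S : ℝ := ∑ n ∈ Finset.range k, SchwartzMap.seminorm ℂ 0 n φ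
  have hS : 0 ≤ S := Finset.sum_nonneg fun n _ => apply_nonneg _ _
  have hb : Integrable (fun x : EuclideanSpace ℝ (Fin d) =>
      ‖φ x‖ + S * 2 ^ (d + 1) * (1 + ‖x‖) ^ (-((d : ℝ) + 1))) :=
    φ.integrable.norm.add ((integrable_one_add_norm (by simp)).const_mul _)
  have hfar : IntegrableOn (fun x => radialAmplitude d (inversePower (d + k)) x *
      taylorSubtract (fun y => cutoffWeight μ ‖y‖) k φ x) (Metric.ball 0 R)ᶜ := by
    refine hb.integrableOn.mono' ?_ ?_
    · exact ((measurable_radialAmplitude_inversePower d (d + k)).mul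
        (measurable_taylorSubtract ((measurable_cutoffWeight μ).comp measurable_norm) k
          φ)).aestronglyMeasurable
    · filter_upwards [ae_restrict_mem measurableSet_ball.compl] with x hx
      rw [mem_compl_iff, mem_ball_zero_iff, not_lt] at hx
      have h1 : 1 ≤ ‖x‖ := by linarith
      have hx0 : 0 < ‖x‖ := by linarith
      have hc : cutoffWeight μ ‖x‖ = 0 := by
        rw [cutoffWeight, if_neg (by linarith)]
      rw [norm_mul, norm_radialAmplitude_inversePower, taylorSubtract, hc, zero_mul, sub_zero]
      have hn : ∀ n ∈ Finset.range k, (‖x‖ ^ (d + k))⁻¹ * ‖taylorPart φ n x‖ ≤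
          SchwartzMap.seminorm ℂ 0 n φ * (2 ^ (d + 1) * (1 + ‖x‖) ^ (-((d : ℝ) + 1))) := by
        intro n hn
        have hn' := Finset.mem_range.1 hn
        have e : (1 + ‖x‖) ^ (-((d : ℝ) + 1)) = ((1 + ‖x‖) ^ (d + 1))⁻¹ := by
          rw [Real.rpow_neg (by positivity)]
          norm_cast
        calc (‖x‖ ^ (d + k))⁻¹ * ‖taylorPart φ n x‖
            ≤ (‖x‖ ^ (d + k))⁻¹ * (SchwartzMap.seminorm ℂ 0 n φ * ‖x‖ ^ n) := by
              gcongr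
              exact norm_taylorPart_le φ n x
          _ ≤ SchwartzMap.seminorm ℂ 0 n φ * (‖x‖ ^ (d + 1))⁻¹ := by
              rw [mul_left_comm]
              gcongr
              rw [inv_mul_le_iff₀ (by positivity), ← div_eq_mul_inv, le_div_iff₀ (by positivity),
                ← pow_add]
              exact pow_le_pow_right₀ h1 (by omega)
          _ ≤ _ := by
              gcongr
              -- The factor `2^(d+1)` comes from `1 + ‖x‖ ≤ 2 ‖x‖`.
              rw [e, ← div_eq_mul_inv, le_div_iff₀ (by positivity), inv_mul_le_iff₀ (by positivity),
                ← mul_pow]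
              gcongr
              linarith
      calc (‖x‖ ^ (d + k))⁻¹ * ‖φ x - ∑ n ∈ Finset.range k, taylorPart φ n x‖
          ≤ (‖x‖ ^ (d + k))⁻¹ * (‖φ x‖ + ∑ n ∈ Finset.range k, ‖taylorPart φ n x‖) := by
            gcongr
            exact (norm_sub_le _ _).trans (add_le_add le_rfl (norm_sum_le _ _))
        _ = (‖x‖ ^ (d + k))⁻¹ * ‖φ x‖ +
            ∑ n ∈ Finset.range k, (‖x‖ ^ (d + k))⁻¹ * ‖taylorPart φ n x‖ := by
            rw [mul_add, Finset.mul_sum]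
        _ ≤ ‖φ x‖ + ∑ n ∈ Finset.range k, SchwartzMap.seminorm ℂ 0 n φ *
            (2 ^ (d + 1) * (1 + ‖x‖) ^ (-((d : ℝ) + 1))) := by
            refine add_le_add ?_ (Finset.sum_le_sum hn)
            exact mul_le_of_le_one_left (norm_nonneg _)
              (inv_le_one_of_one_le₀ (one_le_pow₀ h1))
        _ = _ := by rw [← Finset.sum_mul, mul_assoc]
  rw [← integrableOn_univ, ← union_compl_self (Metric.ball (0 : EuclideanSpace ℝ (Fin d)) R)]
  exact hloc.union hfar

/-- Every continuous functional on the line induces a distribution on `ℝ^d` reducing to it. -/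
theorem isReduction_comp_sphericalSumCLM (A : 𝓢(ℝ, ℂ) →L[ℂ] ℂ) :
    IsReduction (ContinuousLinearMap.toPointwiseConvergenceCLM _ _ _ _ (A.comp (sphericalSumCLM d)))
      (ContinuousLinearMap.toPointwiseConvergenceCLM _ _ _ _ A) := by
  intro φ ψ h
  have : sphericalSumCLM d φ = ψ := by
    ext r
    rw [sphericalSumCLM_apply, h]
  change A (sphericalSumCLM d φ) = A ψ
  rw [this]

/-- `T` is defined as `S` composed with the continuous map `P`, so temperedness and the reduction
formula are automatic; that `T` is the `T_w` extension on `ℝ^d` is then the equivalence of Cesàro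
evaluations. -/
theorem exists_isWeightedExtension (hd : 1 ≤ d) (k : ℕ) {w : ℝ → ℂ} (hw : IsRadialWeight w) :
    ∃ (T : 𝓢'(EuclideanSpace ℝ (Fin d), ℂ)) (S : 𝓢'(ℝ, ℂ)),
      IsWeightedExtension (radialAmplitude d (inversePower (d + k))) (fun x => w ‖x‖) k T ∧
      IsExtensionOf (radialAmplitude d (inversePower (d + k))) T ∧
      IsWeightedExtension (reducedAmplitude d (inversePower (d + k))) (fun x => w ‖x‖) k S ∧
      IsExtensionOf (reducedAmplitude d (inversePower (d + k))) S ∧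
      IsReduction T S := by
  obtain ⟨c, hc⟩ := hw.hasCesaroIntegral
  set A : 𝓢(ℝ, ℂ) →L[ℂ] ℂ := finitePart k + c • taylorPartCLM k 1
  have hS : IsWeightedExtension (reducedAmplitude d (inversePower (d + k))) (fun x => w ‖x‖) k
      (ContinuousLinearMap.toPointwiseConvergenceCLM _ _ _ _ A) := by
    rw [reducedAmplitude_inversePower hd]
    exact hc k
  have hT : IsWeightedExtension (radialAmplitude d (inversePower (d + k))) (fun x => w ‖x‖) k
      (ContinuousLinearMap.toPointwiseConvergenceCLM _ _ _ _ (A.comp (sphericalSumCLM d))) :=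
    fun φ => (hasCesaroIntegral_radial_iff hd (integrableOn_inversePower_mul_pow (d + k))
      (hw.integrableOn_inversePower_mul hd k) φ _).2 (hS (sphericalSumCLM d φ))
  refine ⟨_, _, hT, ?_, hS, ?_, isReduction_comp_sphericalSumCLM A⟩
  · exact hT.isExtensionOf (measurable_radialAmplitude_inversePower d (d + k))
      fun x => (norm_radialAmplitude_inversePower d (d + k) x).le
  · rw [reducedAmplitude_inversePower hd] at hS ⊢
    exact hS.isExtensionOf ((measurable_inversePower _).indicator measurableSet_Ioi)
      (norm_indicator_inversePower_le (k + 1))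

theorem exists_isCutoffExtension (hd : 1 ≤ d) (k : ℕ) {μ : ℝ} (hμ : 0 < μ) :
    ∃ (T : 𝓢'(EuclideanSpace ℝ (Fin d), ℂ)) (S : 𝓢'(ℝ, ℂ)),
      IsCutoffExtension (radialAmplitude d (inversePower (d + k))) μ k T ∧
      IsExtensionOf (radialAmplitude d (inversePower (d + k))) T ∧
      IsCutoffExtension (reducedAmplitude d (inversePower (d + k))) μ k S ∧
      IsExtensionOf (reducedAmplitude d (inversePower (d + k))) S ∧
      IsReduction T S := by
  obtain ⟨T, S, h₁, h₂, h₃, h₄, h₅⟩ :=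
    exists_isWeightedExtension hd k (isRadialWeight_cutoffWeight hμ)
  refine ⟨T, S, h₁.isCutoffExtension
    (integrable_radialAmplitude_mul_taylorSubtract_cutoff hd hμ k), h₂,
    h₃.isCutoffExtension fun ψ => ?_, h₄, h₅⟩
  rw [reducedAmplitude_inversePower hd]
  exact integrable_indicator_mul_taylorSubtract_cutoff hμ k ψ

/-- The absolutely convergent integral on `ℝ^d` is carried to the line as a Cesàro integral, where
it is again absolutely convergent and splits into the finite part and the `log μ` term. -/
theorem IsCutoffExtension.apply_eq (hd : 1 ≤ d) {k : ℕ} {μ : ℝ} (hμ : 0 < μ)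
    {T : 𝓢'(EuclideanSpace ℝ (Fin d), ℂ)}
    (hT : IsCutoffExtension (radialAmplitude d (inversePower (d + k))) μ k T)
    (φ : 𝓢(EuclideanSpace ℝ (Fin d), ℂ)) :
    T φ = finitePart k (sphericalSumCLM d φ) +
      Real.log μ * (iteratedDeriv k (sphericalSum φ) 0 / k.factorial) := by
  obtain ⟨hi, hTφ⟩ := hT φ
  have h := (hasCesaroIntegral_radial_iff hd (integrableOn_inversePower_mul_pow (d + k))
    ((isRadialWeight_cutoffWeight hμ).integrableOn_inversePower_mul hd k) φ _).1
    hi.hasCesaroIntegral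
  rw [reducedAmplitude_inversePower hd, ← coe_sphericalSumCLM] at h
  rw [hTφ, h.eq_integral (integrable_indicator_mul_taylorSubtract_cutoff hμ k _),
    integral_indicator_mul_taylorSubtract_cutoff hμ, taylorPart_real, coe_sphericalSumCLM]
  simp

theorem TemperedDistribution.iterate_laplacian_apply {E : Type*} [NormedAddCommGroup E]
    [InnerProductSpace ℝ E] [FiniteDimensional ℝ E] (T : 𝓢'(E, ℂ)) (m : ℕ) (φ : 𝓢(E, ℂ)) :
    ((Δ^[m]) T) φ = T ((Δ^[m]) φ) := by
  induction m generalizing φ with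
  | zero => rfl
  | succ m ih =>
    rw [Function.iterate_succ_apply', TemperedDistribution.laplacian_apply_apply, ih,
      ← Function.iterate_succ_apply]

/-- The extension `T_μ (r^(-d-2m))` compared with the finite part. -/
theorem IsCutoffExtension.eq_finitePart_add (hd : 1 ≤ d) {m : ℕ} {μ : ℝ} (hμ : 0 < μ)
    {T : 𝓢'(EuclideanSpace ℝ (Fin d), ℂ)}
    (hT : IsCutoffExtension (radialAmplitude d (inversePower (d + 2 * m))) μ (2 * m) T)
    (i : Fin d) :
    T = ContinuousLinearMap.toPointwiseConvergenceCLM _ _ _ _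
        ((finitePart (2 * m)).comp (sphericalSumCLM d)) +
      ((sphereMoment i m / ((2 * m).factorial : ℝ) * Real.log μ : ℝ) : ℂ) •
        (Δ^[m]) (TemperedDistribution.delta (0 : EuclideanSpace ℝ (Fin d))) := by
  have : Nonempty (Fin d) := ⟨i⟩
  ext φ
  rw [hT.apply_eq hd hμ φ, iteratedDeriv_even_sphericalSum φ m i, add_apply, smul_apply,
    TemperedDistribution.iterate_laplacian_apply, TemperedDistribution.delta_apply, smul_eq_mul]
  change _ = finitePart (2 * m) (sphericalSumCLM d φ) + _
  push_cast
  ring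

end Extension

end

theorem proposition2 (d : ℕ) (hd : 1 ≤ d) :
    -- the spherical average of a Schwartz function is an (even) Schwartz function on the line
    (∀ φ : 𝓢(EuclideanSpace ℝ (Fin d), ℂ),
      (∃ ψ : 𝓢(ℝ, ℂ), ∀ r, ψ r = sphericalSum φ r) ∧
      (∀ r, sphericalSum φ (-r) = sphericalSum φ r)) ∧
    -- its derivatives at the origin
    (∀ (φ : 𝓢(EuclideanSpace ℝ (Fin d), ℂ)) (m : ℕ),
      iteratedDeriv (2 * m + 1) (sphericalSum φ) 0 = 0 ∧
      ∀ i : Fin d, iteratedDeriv (2 * m) (sphericalSum φ) 0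
        = (sphereMoment i m : ℂ) * ((Δ^[m]) φ) 0) ∧
    -- radial amplitudes and radial weights: the two evaluations exist together and agree
    (∀ (k : ℕ) (f w : ℝ → ℂ),
      (∀ R : ℝ, IntegrableOn (fun r : ℝ => f r * (r : ℂ) ^ (d + k)) (Ioc 0 R)) →
      (∀ R : ℝ, IntegrableOn (fun r : ℝ => f r * (r : ℂ) ^ (d - 1 + k) * (1 - w r)) (Ioc 0 R)) →
      ∀ (φ : 𝓢(EuclideanSpace ℝ (Fin d), ℂ)) (L : ℂ),
        HasCesaroIntegral (fun x : EuclideanSpace ℝ (Fin d) =>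
            radialAmplitude d f x * taylorSubtract (fun y => w ‖y‖) k φ x) L ↔
        HasCesaroIntegral (fun r : ℝ =>
            reducedAmplitude d f r * taylorSubtract (fun s => w ‖s‖) k (sphericalSum φ) r) L) ∧
    -- `T_w` extensions of `r ^ (-d-k)`
    (∀ (k : ℕ) (w : ℝ → ℂ), IsRadialWeight w →
      ∃ (T : 𝓢'(EuclideanSpace ℝ (Fin d), ℂ)) (S : 𝓢'(ℝ, ℂ)),
        IsWeightedExtension (radialAmplitude d (inversePower (d + k))) (fun x => w ‖x‖) k T ∧
        IsExtensionOf (radialAmplitude d (inversePower (d + k))) T ∧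
        IsWeightedExtension (reducedAmplitude d (inversePower (d + k))) (fun x => w ‖x‖) k S ∧
        IsExtensionOf (reducedAmplitude d (inversePower (d + k))) S ∧
        IsReduction T S) ∧
    -- `T_μ` extensions of `r ^ (-d-k)`
    (∀ (k : ℕ) (μ : ℝ), 0 < μ →
      ∃ (T : 𝓢'(EuclideanSpace ℝ (Fin d), ℂ)) (S : 𝓢'(ℝ, ℂ)),
        IsCutoffExtension (radialAmplitude d (inversePower (d + k))) μ k T ∧
        IsExtensionOf (radialAmplitude d (inversePower (d + k))) T ∧
        IsCutoffExtension (reducedAmplitude d (inversePower (d + k))) μ k S ∧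
        IsExtensionOf (reducedAmplitude d (inversePower (d + k))) S ∧
        IsReduction T S) ∧
    -- comparison with the finite part of `r ^ (-d-2m)`
    (∀ m : ℕ, ∃ (Pf : 𝓢'(EuclideanSpace ℝ (Fin d), ℂ)) (Pf₁ : 𝓢'(ℝ, ℂ)),
      IsPseudofunction (2 * m + 1) Pf₁ ∧ IsReduction Pf Pf₁ ∧
      ∀ (μ : ℝ), 0 < μ → ∀ T : 𝓢'(EuclideanSpace ℝ (Fin d), ℂ),
        IsCutoffExtension (radialAmplitude d (inversePower (d + 2 * m))) μ (2 * m) T →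
        ∀ i : Fin d, T = Pf +
          ((sphereMoment i m / ((2 * m).factorial : ℝ) * Real.log μ : ℝ) : ℂ) •
            (Δ^[m]) (TemperedDistribution.delta (0 : EuclideanSpace ℝ (Fin d)))) := by
  have hn : Nonempty (Fin d) := ⟨⟨0, hd⟩⟩
  refine ⟨fun φ => ⟨⟨sphericalSumCLM d φ, sphericalSumCLM_apply φ⟩, sphericalSum_neg φ⟩,
    fun φ m => ⟨iteratedDeriv_odd_sphericalSum φ m, iteratedDeriv_even_sphericalSum φ m⟩,
    fun k f w h₁ h₂ φ L => hasCesaroIntegral_radial_iff hd h₁ h₂ φ L,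
    fun k w hw => exists_isWeightedExtension hd k hw,
    fun k μ hμ => exists_isCutoffExtension hd k hμ,
    fun m => ⟨_, _, isPseudofunction_finitePart (2 * m),
      isReduction_comp_sphericalSumCLM (finitePart (2 * m)),
      fun μ hμ T hT i => hT.eq_finitePart_add hd hμ i⟩⟩
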